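/- There are absolute constants $K>0$ and $n_0$ such that the following holds for every $n\ge n_0$. Let $b$ be $20\log_2 n$ rounded to an integer, either up or down, let $\Lambda=\{0,1\}^b$, and let $G:\Lambda\times\Lambda\to\{0,1\}$, $G(u,v)=\sum_j u_jv_j \bmod 2$, be the inner product gadget. Let $f:\{0,1\}^n\to\{\pm1\}$ and let $f\circ G^n:\Lambda^n\times\Lambda^n\to\{\pm1\}$ be $f\circ G^n(x,y)=f(G(x_1,y_1),\dots,G(x_n,y_n))$. Suppose that a hybrid two-party protocol computes $f\circ G^n$ with error $0.1$, that is, on every input $(x,y)$ it outputs $f\circ G^n(x,y)$ with probability at least $0.9$. Here a hybrid protocol first lets Alice (who knows $x$) and Bob (who knows $y$) alternately and deterministically send $c$ classical bits in total, each bit being a function of the sender's input and the previous bits. Then they run a $q$-round quantum protocol with prior entanglement, in which both also know the classical transcript $m$: the state space is $H_A\otimes\mathbb C^2\otimes H_B$ with $H_A,H_B$ finite-dimensional; the initial state is $\sum_{w,w'}\alpha_{w,w'}\,|x,m,w\rangle|0\rangle|y,m,w'\rangle$ for a fixed shared unit vector $\alpha$ that depends neither on the input nor on $m$; in alternate rounds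 Alice applies a unitary to $H_A\otimes\mathbb C^2$ and Bob applies a unitary to $\mathbb C^2\otimes H_B$; finally the protocol outputs $-1$ with probability equal to the squared length of the projection of the state onto $H_A\otimes|1\rangle\otimes H_B$, and $1$ otherwise. Then there is a deterministic decision tree that queries at most $200c/b$ of the $n$ input bits of $f$ such that, for every outcome of the queries, $$\deg_{1/3}(f_{J,z})\le K\cdot\frac qb,$$ where $J\subseteq[n]$ is the set of unqueried coordinates, $z\in\{0,1\}^{[n]\setminus J}$ is the vector of answers, and $f_{J,z}:\{0,1\}^J\to\{\pm1\}$ is $f$ with the coordinates outside $J$ fixed to $z$. Here $\deg_{1/3}(g)$ is the smallest degree of a function $p:\{0,1\}^J\to\mathbb R$ with $\max_u|g(u)-p(u)|\le 1/3$, and the degree of $p$ is the largest $|S|$ whose Fourier coefficient $\widehat p_S$ is nonzero. -/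

import Mathlib

noncomputable section

namespace HybridLifting

/-- The set `{0,1}`, with exclusive or as addition and conjunction as multiplication. -/
abbrev Bit : Type := ZMod 2

/-! ### Boolean functions: Fourier expansion, degree, approximate degree, restrictions -/

section BooleanFunctions

variable {ι : Type} [Fintype ι] [DecidableEq ι]

/-- The character `χ_S(x) = ∏_{i ∈ S} (-1)^{x_i}`. -/
def character (S : Finset ι) (x : ι → Bit) : ℝ :=
  ∏ i ∈ S, (-1 : ℝ) ^ (x i).val

/-- The Fourier coefficient of `p` at `S`, normalised so that `p = ∑_S (fourierCoeff p S) χ_S`. -/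
def fourierCoeff (p : (ι → Bit) → ℝ) (S : Finset ι) : ℝ :=
  (∑ x : ι → Bit, p x * character S x) / 2 ^ Fintype.card ι

open Classical in
/-- The largest size of a set `S` with nonzero Fourier coefficient (`0` for the zero function). -/
def degree (p : (ι → Bit) → ℝ) : ℕ :=
  (Finset.univ.filter fun S : Finset ι => fourierCoeff p S ≠ 0).sup Finset.card

/-- The `ε`-approximate degree of `f`: the smallest degree of a real function within `ε` of `f`
in the maximum norm. -/
def approxDegree (ε : ℝ) (f : (ι → Bit) → ℤˣ) : ℕ :=
  sInf {d : ℕ | ∃ p : (ι → Bit) → ℝ, degree p = d ∧ ∀ x, |((f x : ℤ) : ℝ) - p x| ≤ ε}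

end BooleanFunctions

/-- `f_{J,z}`: the function on `{0,1}^J` obtained from `f` by fixing the coordinates outside `J`
to `z`. -/
def restriction {n : ℕ} (f : (Fin n → Bit) → ℤˣ) (J : Finset (Fin n))
    (z : {i : Fin n // i ∉ J} → Bit) : ({i : Fin n // i ∈ J} → Bit) → ℤˣ :=
  fun x => f fun i => if h : i ∈ J then x ⟨i, h⟩ else z ⟨i, h⟩

/-! ### Deterministic decision trees -/

/-- A deterministic decision tree on `n` bits. Leaves carry no label: what matters at a leaf is
which coordinates were queried and what the answers were. -/
inductive DecisionTree (n : ℕ) : Type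
  | leaf : DecisionTree n
  | query (i : Fin n) (child : Bit → DecisionTree n) : DecisionTree n

namespace DecisionTree

/-- The largest number of queries on a path from the root to a leaf. -/
def depth {n : ℕ} : DecisionTree n → ℕ
  | leaf => 0
  | query _ child => max (child 0).depth (child 1).depth + 1

/-- The set of coordinates queried on input `x`. -/
def queried {n : ℕ} : DecisionTree n → (Fin n → Bit) → Finset (Fin n)
  | leaf, _ => ∅
  | query i child, x => insert i ((child (x i)).queried x)

/-- The set `J` of coordinates that are not queried on input `x`. -/
def unqueried {n : ℕ} (T : DecisionTree n) (x : Fin n → Bit) : Finset (Fin n) :=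
  (T.queried x)ᶜ

/-- The answers received on input `x`, as an assignment to the queried coordinates. -/
def answers {n : ℕ} (T : DecisionTree n) (x : Fin n → Bit) :
    {i : Fin n // i ∉ T.unqueried x} → Bit :=
  fun i => x i

end DecisionTree

/-! ### Classical deterministic communication -/

/-- A deterministic protocol in which Alice and Bob alternately send single bits. Rounds are
numbered from `0` here, so Alice speaks in the rounds with even number. In round `i` the speaker's
bit is an arbitrary function of the speaker's input and of the first `i` bits. -/
structure ClassicalProtocol (X Y : Type) where
  alice : (i : ℕ) → X → (Fin i → Bit) → Bit
  bob : (i : ℕ) → Y → (Fin i → Bit) → Bit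

/-- The transcript of the first `c` bits on input `(x, y)`. -/
def ClassicalProtocol.transcript {X Y : Type} (P : ClassicalProtocol X Y) (x : X) (y : Y) :
    (c : ℕ) → (Fin c → Bit)
  | 0 => Fin.elim0
  | i + 1 =>
    let m := P.transcript x y i
    Fin.snoc (α := fun _ => Bit) m (if Even i then P.alice i x m else P.bob i y m)

/-! ### Quantum communication with prior entanglement -/

section Quantum

variable {X Y : Type} [Fintype X] [DecidableEq X] [Fintype Y] [DecidableEq Y]

/-- A quantum protocol with prior entanglement. `H_A` has orthonormal basis `X × Fin kA` (an input
register and a workspace), `H_B` has orthonormal basis `Y × Fin kB`, and the channel is one qubit.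
The workspaces start in the bipartite pure state `∑ α_{w,w'} |w⟩ |w'⟩`, which is arbitrary.
In each round one party, alternately, applies a unitary to that party's side and the channel. -/
structure QuantumProtocol (X Y : Type) [Fintype X] [DecidableEq X]
    [Fintype Y] [DecidableEq Y] where
  kA : ℕ
  kB : ℕ
  entanglement : Fin kA → Fin kB → ℂ
  entanglement_norm : ∑ w, ∑ w', ‖entanglement w w'‖ ^ 2 = 1
  aliceFirst : Bool
  aliceU : ℕ → Matrix.unitaryGroup ((X × Fin kA) × Bit) ℂ
  bobU : ℕ → Matrix.unitaryGroup (Bit × (Y × Fin kB)) ℂ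

namespace QuantumProtocol

/-- Vectors of `H_A ⊗ C ⊗ H_B`, in coordinates. -/
abbrev State (P : QuantumProtocol X Y) : Type :=
  (X × Fin P.kA) → Bit → (Y × Fin P.kB) → ℂ

/-- The initial state `∑ α_{w,w'} |x,w⟩ |0⟩ |y,w'⟩`. -/
def initialState (P : QuantumProtocol X Y) (x : X) (y : Y) : P.State :=
  fun a s b => if a.1 = x ∧ s = 0 ∧ b.1 = y then P.entanglement a.2 b.2 else 0

/-- The action of `U ⊗ I_B`. -/
def applyAlice (P : QuantumProtocol X Y) (U : Matrix.unitaryGroup ((X × Fin P.kA) × Bit) ℂ)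
    (ψ : P.State) : P.State :=
  fun a s b => ∑ a', ∑ s', U.1 (a, s) (a', s') * ψ a' s' b

/-- The action of `I_A ⊗ U`. -/
def applyBob (P : QuantumProtocol X Y) (U : Matrix.unitaryGroup (Bit × (Y × Fin P.kB)) ℂ)
    (ψ : P.State) : P.State :=
  fun a s b => ∑ s', ∑ b', U.1 (s, b) (s', b') * ψ a s' b'

/-- The state after the given number of rounds. -/
def stateAfter (P : QuantumProtocol X Y) (x : X) (y : Y) : ℕ → P.State
  | 0 => P.initialState x y
  | i + 1 =>
    if Even i ↔ P.aliceFirst = true then P.applyAlice (P.aliceU i) (P.stateAfter x y i)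
    else P.applyBob (P.bobU i) (P.stateAfter x y i)

/-- The probability that the `t`-round protocol outputs `-1`: the squared length of the projection
of the final state onto `H_A ⊗ |1⟩ ⊗ H_B`. -/
def probNegOne (P : QuantumProtocol X Y) (t : ℕ) (x : X) (y : Y) : ℝ :=
  ∑ a, ∑ b, ‖P.stateAfter x y t a 1 b‖ ^ 2

/-- The probability that the `t`-round protocol outputs `v`. -/
def probOutput (P : QuantumProtocol X Y) (t : ℕ) (x : X) (y : Y) (v : ℤˣ) : ℝ :=
  if v = -1 then P.probNegOne t x y else 1 - P.probNegOne t x y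

end QuantumProtocol

/-! ### Hybrid classical-quantum communication -/

/-- A hybrid protocol: `c` classical bits, followed by `q` rounds of one-qubit quantum
communication. In the quantum phase each party's input register holds the party's input and the
classical transcript; the shared entangled state is fixed in advance. -/
structure HybridProtocol (X Y : Type) [Fintype X] [DecidableEq X]
    [Fintype Y] [DecidableEq Y] (c q : ℕ) where
  classical : ClassicalProtocol X Y
  quantum : QuantumProtocol (X × (Fin c → Bit)) (Y × (Fin c → Bit))

/-- The protocol outputs `F(x, y)` with probability at least `1 - ε` on every input. -/
def HybridProtocol.Computes {c q : ℕ} (P : HybridProtocol X Y c q) (F : X → Y → ℤˣ)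
    (ε : ℝ) : Prop :=
  ∀ x y, 1 - ε ≤
    P.quantum.probOutput q (x, P.classical.transcript x y c) (y, P.classical.transcript x y c)
      (F x y)

end Quantum

/-! ### Composition with the inner product gadget -/

/-- The gadget `G : {0,1}^b × {0,1}^b → {0,1}`, the inner product modulo `2`. -/
def innerProductGadget {b : ℕ} (x y : Fin b → Bit) : Bit :=
  ∑ j, x j * y j

/-- The composed function `f ∘ G^n`. -/
def composed {n : ℕ} (b : ℕ) (f : (Fin n → Bit) → ℤˣ) (x y : Fin n → Fin b → Bit) : ℤˣ :=
  f fun i => innerProductGadget (x i) (y i)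

end HybridLifting

end

noncomputable section

namespace HybridLifting

open Finset

/-! ### Signs and characters -/

/-! A decision tree simulates the classical phase; at each leaf, Fourier analysis on the surviving
rectangle handles the quantum phase.

The simulation keeps a rectangle `A × B` with constant transcript, on which the gadget takes the
answered values off `J`, and whose sides are `Dense` on `J` (high blockwise min-entropy). A bit sent
is followed into the larger half of the sender's side, which weakens density there.
`restore_density_step` repairs it by fixing a maximal over-frequent pattern `a` on a set `I`, which
the tree then queries; to match the answers `z`, the other side is cut to the `y` with `G(a_i, y_i)
= z_i` on `I`. This cut neither empties that side nor ruins its density, because `exists_safe_half`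
has first discarded the `x` whose gadget signs are unbalanced on the other side or its subcubes. Few
`x` are lost, since sign matrices have small second moments on dense rectangles
(`sum_sq_gadgetSign_le`). The cut side keeps only the weaker density and is repaired in turn
(`reachable_of_restored`).

Queries are counted by a potential, the product of the two `Spread` factors, which is never below 1.
Each bit costs at most a factor 4, and each query gains at least `r₁ * 2 ^ b / 8 ≥ n / 16`. As `b`
is about `20 log₂ n`, only `O(c / b)` queries occur.

At a leaf the transcript is fixed, and the acceptance probability is an inner product of a vector
depending on `x` and one depending on `y`, of squared length at most `4 ^ q` whatever the
entanglement (`exists_probNegOne_eq`). Its correlation with the gadget character of `S` on the dense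
rectangle is therefore at most `4 ^ q * n ^ (-8|S|)`. Pushing the output bias forward along the
gadget, whose values on `J` are nearly uniform, gives a function close to `f_{J,z}` whose Fourier
weight above level `O(q / b)` is negligible; its truncation is the approximant
(`approxDegree_restriction_le`). -/

/-- The sign `(-1)^a` of a bit. -/
def sign (a : Bit) : ℝ := (-1) ^ a.val

lemma bit_cases (a : Bit) : a = 0 ∨ a = 1 := by
  revert a; decide

@[simp] lemma sign_zero : sign 0 = 1 := by simp [sign]

@[simp] lemma sign_one : sign 1 = -1 := by
  have : (1 : Bit).val = 1 := rfl
  simp [sign, this]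

lemma sign_add (a b : Bit) : sign (a + b) = sign a * sign b := by
  have h : (1 + 1 : Bit) = 0 := rfl
  rcases bit_cases a with rfl | rfl <;> rcases bit_cases b with rfl | rfl <;> simp [h]

lemma sign_sum {κ : Type*} (s : Finset κ) (f : κ → Bit) :
    sign (∑ j ∈ s, f j) = ∏ j ∈ s, sign (f j) := by
  classical
  induction s using Finset.induction_on with
  | empty => simp
  | insert a s ha ih => rw [sum_insert ha, prod_insert ha, sign_add, ih]

lemma abs_sign (a : Bit) : |sign a| = 1 := by
  rcases bit_cases a with rfl | rfl <;> simp

lemma one_add_sign_mul_sign (a b : Bit) : 1 + sign a * sign b = if a = b then 2 else 0 := by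
  rcases bit_cases a with rfl | rfl <;> rcases bit_cases b with rfl | rfl <;> norm_num

section Characters

variable {ι : Type}

lemma character_eq_prod_sign (S : Finset ι) (x : ι → Bit) :
    character S x = ∏ i ∈ S, sign (x i) := rfl

lemma abs_character (S : Finset ι) (x : ι → Bit) : |character S x| = 1 := by
  simp [character_eq_prod_sign, abs_prod, abs_sign]

variable [Fintype ι] [DecidableEq ι]

/-- Expansion of the indicator of agreement on `I` into characters. -/
lemma sum_powerset_character_mul_character (I : Finset ι) (z w : ι → Bit) :
    ∑ S ∈ I.powerset, character S z * character S w =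
      if ∀ i ∈ I, z i = w i then (2 : ℝ) ^ #I else 0 := by
  have h : ∀ S : Finset ι, character S z * character S w = ∏ i ∈ S, sign (z i) * sign (w i) :=
    fun S => by rw [character_eq_prod_sign, character_eq_prod_sign, prod_mul_distrib]
  simp_rw [h, ← Finset.prod_one_add, one_add_sign_mul_sign]
  split_ifs with hz
  · rw [prod_congr rfl fun i hi => if_pos (hz i hi), prod_const]
  · push Not at hz
    obtain ⟨i, hi, hne⟩ := hz
    exact prod_eq_zero hi (if_neg hne)

lemma sum_character_mul_character (z w : ι → Bit) :
    ∑ S : Finset ι, character S z * character S w =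
      if z = w then (2 : ℝ) ^ Fintype.card ι else 0 := by
  have h := sum_powerset_character_mul_character (univ : Finset ι) z w
  simpa [funext_iff, ← Finset.powerset_univ] using h

lemma sum_character_mul_character_point (S T : Finset ι) :
    ∑ x : ι → Bit, character S x * character T x =
      if S = T then (2 : ℝ) ^ Fintype.card ι else 0 := by
  have h : ∀ x : ι → Bit, character S x * character T x =
      ∏ i, (if i ∈ S then sign (x i) else 1) * (if i ∈ T then sign (x i) else 1) := by
    intro x
    rw [prod_mul_distrib, character_eq_prod_sign, character_eq_prod_sign]
    simp
  simp_rw [h]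
  rw [← Fintype.prod_sum (fun i (a : Bit) => (if i ∈ S then sign a else 1) *
    (if i ∈ T then sign a else 1))]
  have hb : ∀ g : Bit → ℝ, ∑ a, g a = g 0 + g 1 := fun g => Fin.sum_univ_two g
  split_ifs with hST
  · subst hST
    rw [prod_congr rfl (g := fun _ => (2 : ℝ))]
    · simp
    · intro i _
      rw [hb]
      by_cases hi : i ∈ S <;> simp [hi] <;> norm_num
  · obtain ⟨i, hi⟩ : ∃ i, ¬ (i ∈ S ↔ i ∈ T) := by
      by_contra hcon
      push Not at hcon
      exact hST (Finset.ext hcon)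
    refine prod_eq_zero (mem_univ i) ?_
    rw [hb]
    by_cases h1 : i ∈ S <;> by_cases h2 : i ∈ T <;> simp_all

end Characters

/-! ### The sign matrices of the gadget -/

section Gadget

variable {ι : Type} {b : ℕ}

/-- The sign `∏_{i ∈ S} (-1)^{G(x_i, y_i)}`. -/
def gadgetSign (S : Finset ι) (x y : ι → Fin b → Bit) : ℝ :=
  character S fun i => innerProductGadget (x i) (y i)

lemma abs_gadgetSign (S : Finset ι) (x y : ι → Fin b → Bit) : |gadgetSign S x y| = 1 :=
  abs_character _ _

lemma gadgetSign_congr_left {S : Finset ι} {x x' : ι → Fin b → Bit} (h : ∀ i ∈ S, x i = x' i)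
    (y : ι → Fin b → Bit) : gadgetSign S x y = gadgetSign S x' y := by
  unfold gadgetSign
  rw [character_eq_prod_sign, character_eq_prod_sign]
  exact prod_congr rfl fun i hi => by rw [h i hi]

variable [Fintype ι] [DecidableEq ι]

lemma innerProductGadget_comm (x y : Fin b → Bit) :
    innerProductGadget x y = innerProductGadget y x := by
  simp [innerProductGadget, mul_comm]

lemma sum_sign_gadget_mul (v w : Fin b → Bit) :
    ∑ u : Fin b → Bit, sign (innerProductGadget u v) * sign (innerProductGadget u w) =
      if v = w then (2 : ℝ) ^ b else 0 := by
  have h : ∀ u : Fin b → Bit, sign (innerProductGadget u v) * sign (innerProductGadget u w) =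
      ∏ j, sign (u j * v j) * sign (u j * w j) := by
    intro u
    rw [innerProductGadget, innerProductGadget, sign_sum, sign_sum, prod_mul_distrib]
  simp_rw [h]
  rw [← Fintype.prod_sum (fun j (a : Bit) => sign (a * v j) * sign (a * w j))]
  have hb : ∀ g : Bit → ℝ, ∑ a, g a = g 0 + g 1 := fun g => Fin.sum_univ_two g
  simp_rw [hb, zero_mul, one_mul, sign_zero, one_mul, one_add_sign_mul_sign]
  split_ifs with hvw
  · subst hvw; simp
  · obtain ⟨j, hj⟩ := Function.ne_iff.mp hvw
    exact prod_eq_zero (mem_univ j) (if_neg hj)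

/-- Orthogonality factorises over coordinates, and those outside `S` contribute only their volume.
All discrepancy bounds below rest on this cancellation. -/
lemma sum_gadgetSign_mul (S : Finset ι) (y y' : ι → Fin b → Bit) :
    ∑ x, gadgetSign S x y * gadgetSign S x y' =
      if ∀ i ∈ S, y i = y' i then ((2 : ℝ) ^ b) ^ Fintype.card ι else 0 := by
  have h : ∀ x : ι → Fin b → Bit, gadgetSign S x y * gadgetSign S x y' =
      ∏ i, (if i ∈ S then sign (innerProductGadget (x i) (y i)) *
        sign (innerProductGadget (x i) (y' i)) else 1) := by
    intro x
    simp [gadgetSign, character_eq_prod_sign, prod_mul_distrib]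
  simp_rw [h]
  rw [← Fintype.prod_sum (fun i (a : Fin b → Bit) => if i ∈ S then
    sign (innerProductGadget a (y i)) * sign (innerProductGadget a (y' i)) else (1 : ℝ))]
  have hi : ∀ i, ∑ a : Fin b → Bit, (if i ∈ S then
      sign (innerProductGadget a (y i)) * sign (innerProductGadget a (y' i)) else (1 : ℝ)) =
      if i ∈ S → y i = y' i then (2 : ℝ) ^ b else 0 := by
    intro i
    by_cases hS : i ∈ S
    · simp only [hS, if_true, true_imp_iff]
      exact sum_sign_gadget_mul _ _
    · simp [hS]
  simp_rw [hi]
  split_ifs with hyy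
  · rw [prod_congr rfl fun i _ => if_pos (hyy i)]
    simp
  · push Not at hyy
    obtain ⟨i, hiS, hne⟩ := hyy
    exact prod_eq_zero (mem_univ i) (if_neg fun h => hne (h hiS))

/-! ### Fibers -/

/-- The points of `A` that agree with `x` on `S`. -/
def fiber (A : Finset (ι → Fin b → Bit)) (S : Finset ι) (x : ι → Fin b → Bit) :
    Finset (ι → Fin b → Bit) :=
  A.filter fun x' => ∀ i ∈ S, x' i = x i

lemma mem_fiber {A : Finset (ι → Fin b → Bit)} {S : Finset ι} {x x' : ι → Fin b → Bit} :
    x' ∈ fiber A S x ↔ x' ∈ A ∧ ∀ i ∈ S, x' i = x i := by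
  simp [fiber]

lemma fiber_subset (A : Finset (ι → Fin b → Bit)) (S : Finset ι) (x : ι → Fin b → Bit) :
    fiber A S x ⊆ A := filter_subset _ _

@[simp] lemma fiber_empty (A : Finset (ι → Fin b → Bit)) (x : ι → Fin b → Bit) :
    fiber A ∅ x = A := by
  simp [fiber]

lemma fiber_mono {A B : Finset (ι → Fin b → Bit)} (h : A ⊆ B) (S : Finset ι)
    (x : ι → Fin b → Bit) : fiber A S x ⊆ fiber B S x :=
  filter_subset_filter _ h

lemma fiber_piecewise (A : Finset (ι → Fin b → Bit)) {S T : Finset ι} (h : Disjoint S T)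
    (x y : ι → Fin b → Bit) :
    fiber (fiber A S x) T y = fiber A (S ∪ T) (S.piecewise x y) := by
  ext w
  simp only [mem_fiber, and_assoc, and_congr_right_iff, mem_union]
  intro _
  constructor
  · rintro ⟨h1, h2⟩ i (hi | hi)
    · rw [piecewise_eq_of_mem _ _ _ hi, h1 i hi]
    · rw [piecewise_eq_of_notMem _ _ _ (disjoint_right.mp h hi), h2 i hi]
  · intro hw
    refine ⟨fun i hi => ?_, fun i hi => ?_⟩
    · rw [hw i (Or.inl hi), piecewise_eq_of_mem _ _ _ hi]
    · rw [hw i (Or.inr hi), piecewise_eq_of_notMem _ _ _ (disjoint_right.mp h hi)]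

lemma card_fiber_univ (S : Finset ι) (x : ι → Fin b → Bit) :
    (2 ^ b) ^ #S * #(fiber univ S x) = (2 ^ b) ^ Fintype.card ι := by
  have h : fiber univ S x = Fintype.piFinset fun i => if i ∈ S then {x i} else univ := by
    ext w
    simp only [mem_fiber, mem_univ, true_and, Fintype.mem_piFinset]
    refine forall_congr' fun i => ?_
    by_cases hi : i ∈ S <;> simp [hi]
  have h2 : ∀ i, #(if i ∈ S then {x i} else (univ : Finset (Fin b → Bit))) =
      if i ∈ S then 1 else 2 ^ b := by
    intro i
    split_ifs <;> simp [ZMod.card]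
  rw [h, Fintype.card_piFinset, prod_congr rfl fun i _ => h2 i, prod_ite, prod_const_one, one_mul,
    prod_const, ← pow_add]
  congr 1
  have := Finset.card_filter_add_card_filter_not (s := (univ : Finset ι)) (fun i => i ∈ S)
  simp only [filter_univ_mem, card_univ] at this
  exact this

/-- A function of the coordinates in `S` is, up to the largest fiber, dominated on `A` by its
sum over the whole space. -/
lemma sum_le_of_fiber_le (A : Finset (ι → Fin b → Bit)) (S : Finset ι) (M : ℝ)
    (hM : ∀ x, (#(fiber A S x) : ℝ) ≤ M) (h : (ι → Fin b → Bit) → ℝ) (h0 : ∀ x, 0 ≤ h x)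
    (hS : ∀ x x', (∀ i ∈ S, x i = x' i) → h x = h x') :
    (∑ x ∈ A, h x) * ((2 : ℝ) ^ b) ^ Fintype.card ι ≤
      M * ((2 : ℝ) ^ b) ^ #S * ∑ x, h x := by
  have hcard : ∀ x : ι → Fin b → Bit, ((2 : ℝ) ^ b) ^ #S * #(fiber univ S x) =
      ((2 : ℝ) ^ b) ^ Fintype.card ι := fun x => by exact_mod_cast card_fiber_univ S x
  -- Each `h x` is spread evenly over the full fiber of `x`; exchanging the sums then counts, for
  -- each `x'`, the points of `A` in its fiber.
  calc (∑ x ∈ A, h x) * ((2 : ℝ) ^ b) ^ Fintype.card ι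
      = ∑ x ∈ A, ((2 : ℝ) ^ b) ^ #S * ∑ x' ∈ fiber univ S x, h x' := by
        rw [sum_mul]
        refine sum_congr rfl fun x _ => ?_
        rw [← hcard x, sum_congr rfl fun x' hx' => hS x' x (mem_fiber.mp hx').2, sum_const,
          nsmul_eq_mul]
        ring
    _ = ((2 : ℝ) ^ b) ^ #S * ∑ x', #(fiber A S x') * h x' := by
        rw [← mul_sum]
        congr 1
        simp_rw [fiber, sum_filter]
        rw [sum_comm]
        refine sum_congr rfl fun x' _ => ?_
        rw [← sum_filter, sum_const, nsmul_eq_mul]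
        congr 3
        ext x
        simp [eq_comm]
    _ ≤ ((2 : ℝ) ^ b) ^ #S * ∑ x', M * h x' := by
        gcongr with x' _
        · exact h0 x'
        · exact hM x'
    _ = _ := by rw [← mul_sum]; ring

/-- Second moment bound for the sign matrix on a rectangle with small fibers. -/
lemma sum_sq_gadgetSign_le (A B : Finset (ι → Fin b → Bit)) (S : Finset ι) (MA MB : ℝ)
    (hA : ∀ x, (#(fiber A S x) : ℝ) ≤ MA) (hB : ∀ y, (#(fiber B S y) : ℝ) ≤ MB)
    (v : (ι → Fin b → Bit) → ℝ) :
    ∑ x ∈ A, (∑ y ∈ B, gadgetSign S x y * v y) ^ 2 ≤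
      MA * MB * ((2 : ℝ) ^ b) ^ #S * ∑ y ∈ B, v y ^ 2 := by
  set Z : ℝ := ((2 : ℝ) ^ b) ^ Fintype.card ι with hZ
  have hZ0 : 0 < Z := by positivity
  have hMA : 0 ≤ MA := le_trans (by positivity) (hA fun _ _ => 0)
  -- The inner sum sees only the coordinates of `x` in `S`, so `A` can be enlarged to the whole
  -- space, where orthogonality applies.
  have h1 := sum_le_of_fiber_le A S MA hA (fun x => (∑ y ∈ B, gadgetSign S x y * v y) ^ 2)
    (fun x => sq_nonneg _) (fun x x' h => by simp_rw [gadgetSign_congr_left h])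
  have h2 : ∑ x, (∑ y ∈ B, gadgetSign S x y * v y) ^ 2 ≤ Z * (MB * ∑ y ∈ B, v y ^ 2) := by
    calc ∑ x, (∑ y ∈ B, gadgetSign S x y * v y) ^ 2
        = ∑ y ∈ B, ∑ y' ∈ B, v y * v y' * ∑ x, gadgetSign S x y * gadgetSign S x y' := by
          simp_rw [sq, sum_mul_sum, mul_sum]
          rw [sum_comm]
          refine sum_congr rfl fun y _ => ?_
          rw [sum_comm]
          refine sum_congr rfl fun y' _ => sum_congr rfl fun x _ => ?_
          ring
      _ = Z * ∑ y ∈ B, ∑ y' ∈ B, if ∀ i ∈ S, y i = y' i then v y * v y' else 0 := by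
          rw [mul_sum]
          refine sum_congr rfl fun y _ => ?_
          rw [mul_sum]
          refine sum_congr rfl fun y' _ => ?_
          rw [sum_gadgetSign_mul]
          split_ifs <;> simp [mul_comm, hZ]
      -- Only pairs in a common fiber survive; AM-GM decouples them, leaving fiber sizes.
      _ ≤ Z * ∑ y ∈ B, ∑ y' ∈ B,
            if ∀ i ∈ S, y i = y' i then v y ^ 2 / 2 + v y' ^ 2 / 2 else 0 := by
          gcongr with y _ y' _
          split_ifs
          · nlinarith [sq_nonneg (v y - v y')]
          · exact le_rfl
      _ = Z * ∑ y ∈ B, #(fiber B S y) * v y ^ 2 := by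
          congr 1
          have e1 : ∀ y y', (if ∀ i ∈ S, y i = y' i then v y ^ 2 / 2 + v y' ^ 2 / 2 else 0) =
              (if ∀ i ∈ S, y i = y' i then v y ^ 2 / 2 else 0) +
              (if ∀ i ∈ S, y i = y' i then v y' ^ 2 / 2 else 0) := by
            intro y y'; split_ifs <;> simp
          simp_rw [e1, sum_add_distrib]
          have e4 : ∑ y ∈ B, ∑ y' ∈ B, (if ∀ i ∈ S, y i = y' i then v y' ^ 2 / 2 else 0) =
              ∑ y' ∈ B, ∑ y ∈ B, (if ∀ i ∈ S, y i = y' i then v y' ^ 2 / 2 else 0) := sum_comm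
          rw [e4, ← sum_add_distrib]
          refine sum_congr rfl fun y _ => ?_
          rw [← sum_filter, ← sum_filter, sum_const, sum_const, nsmul_eq_mul, nsmul_eq_mul]
          have e2 : (B.filter fun y' => ∀ i ∈ S, y i = y' i) = fiber B S y := by
            ext; simp [fiber, eq_comm]
          have e3 : (B.filter fun y' => ∀ i ∈ S, y' i = y i) = fiber B S y := rfl
          rw [e2, e3]; ring
      _ ≤ Z * ∑ y ∈ B, MB * v y ^ 2 := by
          gcongr with y _
          exact hB y
      _ = _ := by rw [← mul_sum]
  have h3 : (∑ x ∈ A, (∑ y ∈ B, gadgetSign S x y * v y) ^ 2) * Z ≤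
      (MA * MB * ((2 : ℝ) ^ b) ^ #S * ∑ y ∈ B, v y ^ 2) * Z :=
    h1.trans ((mul_le_mul_of_nonneg_left h2 (by positivity)).trans_eq (by ring))
  exact le_of_mul_le_mul_right h3 hZ0

/-- The sign matrix has small correlation with inner products of vectors of bounded length. -/
lemma sum_gadgetSign_mul_inner_sq_le {E : Type*} [Fintype E] (A B : Finset (ι → Fin b → Bit))
    (S : Finset ι) (MA MB : ℝ)
    (hA : ∀ x, (#(fiber A S x) : ℝ) ≤ MA) (hB : ∀ y, (#(fiber B S y) : ℝ) ≤ MB)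
    (u v : (ι → Fin b → Bit) → E → ℝ) (C : ℝ) (hu : ∀ x ∈ A, ∑ e, u x e ^ 2 ≤ C)
    (hv : ∀ y ∈ B, ∑ e, v y e ^ 2 ≤ C) :
    (∑ x ∈ A, ∑ y ∈ B, gadgetSign S x y * ∑ e, u x e * v y e) ^ 2 ≤
      MA * MB * ((2 : ℝ) ^ b) ^ #S * (#A * C) * (#B * C) := by
  have hMA : 0 ≤ MA := le_trans (by positivity) (hA fun _ _ => 0)
  have hMB : 0 ≤ MB := le_trans (by positivity) (hB fun _ _ => 0)
  have h1 : ∑ x ∈ A, ∑ y ∈ B, gadgetSign S x y * ∑ e, u x e * v y e =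
      ∑ p ∈ A ×ˢ (univ : Finset E), u p.1 p.2 * ∑ y ∈ B, gadgetSign S p.1 y * v y p.2 := by
    rw [sum_product]
    refine sum_congr rfl fun x _ => ?_
    simp_rw [mul_sum]
    rw [sum_comm]
    exact sum_congr rfl fun e _ => sum_congr rfl fun y _ => by ring
  rw [h1]
  refine (sum_mul_sq_le_sq_mul_sq _ _ _).trans ?_
  have h2 : ∑ p ∈ A ×ˢ (univ : Finset E), u p.1 p.2 ^ 2 ≤ #A * C := by
    rw [sum_product, ← nsmul_eq_mul]
    exact sum_le_card_nsmul _ _ _ hu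
  have h3 : ∑ p ∈ A ×ˢ (univ : Finset E), (∑ y ∈ B, gadgetSign S p.1 y * v y p.2) ^ 2 ≤
      MA * MB * ((2 : ℝ) ^ b) ^ #S * (#B * C) := by
    rw [sum_product_right]
    calc _ ≤ ∑ e : E, MA * MB * ((2 : ℝ) ^ b) ^ #S * ∑ y ∈ B, v y e ^ 2 :=
          sum_le_sum fun e _ => sum_sq_gadgetSign_le A B S MA MB hA hB fun y => v y e
      _ = MA * MB * ((2 : ℝ) ^ b) ^ #S * ∑ y ∈ B, ∑ e, v y e ^ 2 := by
          rw [← mul_sum, sum_comm]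
      _ ≤ _ := by
          gcongr
          rw [← nsmul_eq_mul]
          exact sum_le_card_nsmul _ _ _ hv
  calc _ ≤ (#A * C) * (MA * MB * ((2 : ℝ) ^ b) ^ #S * (#B * C)) :=
        mul_le_mul h2 h3 (sum_nonneg fun _ _ => sq_nonneg _)
          ((sum_nonneg fun _ _ => sq_nonneg _).trans h2)
    _ = _ := by ring

end Gadget

/-! ### Density -/

section Density

variable {n b : ℕ}

/-- Every pattern on a set `S` of coordinates in `J` has frequency at most `r ^ |S|` in `A`. -/
def Dense (r : ℝ) (J : Finset (Fin n)) (A : Finset (Fin n → Fin b → Bit)) : Prop :=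
  ∀ S ⊆ J, ∀ x, (#(fiber A S x) : ℝ) ≤ r ^ #S * #A

/-- Every pattern on `J` has frequency in `A` at most `φ` times that in the uniform
distribution. -/
def Spread (φ : ℝ) (J : Finset (Fin n)) (A : Finset (Fin n → Fin b → Bit)) : Prop :=
  ∀ x, (#(fiber A J x) : ℝ) * ((2 : ℝ) ^ b) ^ #J ≤ φ * #A

/-- The frequencies of the patterns on `J` average to the uniform one. This floor is what turns the
product of spreads into a bound on the number of queries. -/
lemma Spread.one_le {φ : ℝ} {J : Finset (Fin n)} {A : Finset (Fin n → Fin b → Bit)}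
    (h : Spread φ J A) (hA : A.Nonempty) : 1 ≤ φ := by
  have hc : (0 : ℝ) < #A := by exact_mod_cast hA.card_pos
  set Z : ℝ := ((2 : ℝ) ^ b) ^ #J with hZ
  have hZ0 : 0 < Z := by positivity
  have h1 := sum_le_of_fiber_le A J (φ * #A / Z) (fun x => by rw [le_div_iff₀ hZ0]; exact h x)
    (fun _ => 1) (fun _ => zero_le_one) (fun _ _ _ => rfl)
  simp only [sum_const, nsmul_eq_mul, mul_one, card_univ, Fintype.card_fun, Fintype.card_fin,
    ZMod.card, Nat.cast_pow, Nat.cast_ofNat] at h1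
  rw [← hZ, div_mul_cancel₀ _ hZ0.ne'] at h1
  have h2 : (0 : ℝ) < ((2 : ℝ) ^ b) ^ n := by positivity
  have h3 := le_of_mul_le_mul_right h1 h2
  nlinarith

lemma Spread.mono_set {φ : ℝ} {J : Finset (Fin n)} {A A' : Finset (Fin n → Fin b → Bit)}
    (h : Spread φ J A) (hA : A.Nonempty) (hA' : A' ⊆ A) {c : ℝ} (hc : (#A : ℝ) ≤ c * #A') :
    Spread (c * φ) J A' := by
  intro x
  have hφ := h.one_le hA
  have h1 : (#(fiber A' J x) : ℝ) ≤ #(fiber A J x) := by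
    exact_mod_cast card_le_card (fiber_mono hA' J x)
  calc (#(fiber A' J x) : ℝ) * ((2 : ℝ) ^ b) ^ #J
      ≤ #(fiber A J x) * ((2 : ℝ) ^ b) ^ #J := by gcongr
    _ ≤ φ * #A := h x
    _ ≤ φ * (c * #A') := by gcongr
    _ = c * φ * #A' := by ring

/-- A dense set remains dense, with a weaker rate, in a subset of half its size. -/
lemma Dense.of_half {r r' : ℝ} {J : Finset (Fin n)} {A A' : Finset (Fin n → Fin b → Bit)}
    (h : Dense r J A) (hr : 0 ≤ r) (hrr : 2 * r ≤ r') (hA' : A' ⊆ A)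
    (hc : (#A : ℝ) ≤ 2 * #A') : Dense r' J A' := by
  intro S hS x
  rcases S.eq_empty_or_nonempty with rfl | hne
  · simp
  have h1 : (#(fiber A' S x) : ℝ) ≤ #(fiber A S x) := by
    exact_mod_cast card_le_card (fiber_mono hA' S x)
  have h2 : 2 * r ^ #S ≤ r' ^ #S := by
    calc 2 * r ^ #S ≤ 2 ^ #S * r ^ #S := by
          gcongr
          exact le_self_pow₀ one_le_two hne.card_pos.ne'
      _ = (2 * r) ^ #S := by rw [mul_pow]
      _ ≤ r' ^ #S := by gcongr
  calc (#(fiber A' S x) : ℝ) ≤ r ^ #S * #A := h1.trans (h S hS x)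
    _ ≤ r ^ #S * (2 * #A') := by gcongr
    _ = 2 * r ^ #S * #A' := by ring
    _ ≤ r' ^ #S * #A' := by gcongr

/-- Rates for the density of the two sides of a rectangle (`r₁` and the weaker `r₂`) and for the
correlations that are tolerated. -/
structure Rates (n b : ℕ) where
  r₁ : ℝ
  r₂ : ℝ
  -- For signs on `S` over a subcube fixing `T`, the tolerated bias is `t ^ |T| * κ ^ |S|`, and `μ ^
  -- |S| * ν ^ |T|` bounds the fraction of points exceeding it. The weight `w` moves slack from `S`
  -- to `T` in the comparison of the two.
  t : ℝ
  κ : ℝ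
  μ : ℝ
  ν : ℝ
  w : ℝ
  r₁_pos : 0 < r₁
  t_pos : 0 < t
  κ_pos : 0 < κ
  κ_le : κ ≤ 1
  μ_nonneg : 0 ≤ μ
  ν_nonneg : 0 ≤ ν
  w_le : 1 ≤ w
  two_r₁ : 2 * r₁ ≤ r₂
  three_t : 3 * t ≤ r₂
  r₁_le_t : r₁ ≤ t
  r₁_le : r₁ ≤ t * κ ^ 2
  moment_le : r₂ * r₁ * 2 ^ b * w ≤ μ * κ ^ 2
  r₁_le_w : r₁ ≤ ν * t ^ 2 * w ^ 2
  union_le : ((1 + μ) ^ n - 1) * (1 + ν) ^ n ≤ 1 / 2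
  correlation_le : (1 + κ) ^ n - 1 ≤ 1 / 2

lemma Rates.r₂_pos (R : Rates n b) : 0 < R.r₂ := by
  have := R.r₁_pos; have := R.two_r₁; linarith

/-- Each coordinate counted by `τ` falls short by a factor `w ^ 2`, while each counted by `s` has a
factor `w` to spare; `2 * τ ≤ s` makes the books balance. -/
lemma Rates.moment_pow_le (R : Rates n b) {s τ : ℕ} (h : 2 * τ ≤ s) :
    (R.r₂ * R.r₁ * 2 ^ b) ^ s * R.r₁ ^ τ ≤ R.μ ^ s * R.ν ^ τ * (R.t ^ τ * R.κ ^ s) ^ 2 := by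
  have hw : 0 < R.w := lt_of_lt_of_le one_pos R.w_le
  have h0 := R.r₂_pos
  have h1 := R.r₁_pos
  have h2 := R.μ_nonneg
  have h3 := R.ν_nonneg
  have h4 : R.w ^ (2 * τ) ≤ R.w ^ s := pow_le_pow_right₀ R.w_le h
  have key : (R.r₂ * R.r₁ * 2 ^ b) ^ s * R.r₁ ^ τ * R.w ^ s ≤
      R.μ ^ s * R.ν ^ τ * (R.t ^ τ * R.κ ^ s) ^ 2 * R.w ^ s := by
    calc (R.r₂ * R.r₁ * 2 ^ b) ^ s * R.r₁ ^ τ * R.w ^ s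
        = (R.r₂ * R.r₁ * 2 ^ b * R.w) ^ s * R.r₁ ^ τ := by rw [mul_pow _ R.w]; ring
      _ ≤ (R.μ * R.κ ^ 2) ^ s * (R.ν * R.t ^ 2 * R.w ^ 2) ^ τ := by
          exact mul_le_mul (pow_le_pow_left₀ (by positivity) R.moment_le s)
            (pow_le_pow_left₀ h1.le R.r₁_le_w τ) (by positivity)
            (pow_nonneg (by positivity) s)
      _ = R.μ ^ s * R.ν ^ τ * (R.t ^ τ * R.κ ^ s) ^ 2 * R.w ^ (2 * τ) := by
          simp only [mul_pow, ← pow_mul]; ring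
      _ ≤ _ := by gcongr
  exact le_of_mul_le_mul_right key (by positivity)

lemma sum_pow_card_fintype (ι : Type*) [Fintype ι] (a : ℝ) :
    ∑ S : Finset ι, a ^ #S = (1 + a) ^ Fintype.card ι := by
  classical
  have h := Finset.prod_one_add (f := fun _ : ι => a) (univ : Finset ι)
  simp only [prod_const, card_univ, powerset_univ] at h
  exact h.symm

lemma sum_pow_card (n : ℕ) (a : ℝ) : ∑ S : Finset (Fin n), a ^ #S = (1 + a) ^ n := by
  rw [sum_pow_card_fintype, Fintype.card_fin]

/-- On every subcube of `B` fixing coordinates in `J`, the signs of `x` on the other coordinates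
in `J` are nearly balanced. -/
def Safe (R : Rates n b) (J : Finset (Fin n)) (B : Finset (Fin n → Fin b → Bit))
    (x : Fin n → Fin b → Bit) : Prop :=
  ∀ S ⊆ J, S.Nonempty → ∀ T ⊆ J, Disjoint S T → ∀ y₀,
    |∑ y ∈ fiber B T y₀, gadgetSign S x y| ≤ R.t ^ #T * R.κ ^ #S * #B

lemma fiber_congr {A : Finset (Fin n → Fin b → Bit)} {S : Finset (Fin n)}
    {x x' : Fin n → Fin b → Bit} (h : x' ∈ fiber A S x) : fiber A S x' = fiber A S x := by
  ext w
  simp only [mem_fiber, and_congr_right_iff]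
  intro _
  exact forall₂_congr fun i hi => by rw [(mem_fiber.mp h).2 i hi]

open Classical in
-- If `|S| ≤ 2|T|`, density alone makes the subcube too small for any violation. Otherwise a
-- second-moment bound applies, and `|S| ≥ 2|T|` gives it enough room.
lemma card_unbalanced_le (R : Rates n b) {J : Finset (Fin n)}
    {A B : Finset (Fin n → Fin b → Bit)} (hA : Dense R.r₂ J A) (hB : Dense R.r₁ J B)
    (hBne : B.Nonempty) {S T : Finset (Fin n)} (hS : S ⊆ J) (hT : T ⊆ J) (hST : Disjoint S T) :
    (#(A.filter fun x => ∃ y₀, R.t ^ #T * R.κ ^ #S * #B <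
      |∑ y ∈ fiber B T y₀, gadgetSign S x y|) : ℝ) ≤ R.μ ^ #S * R.ν ^ #T * #A := by
  have hr₁ := R.r₁_pos
  have hr₂ := R.r₂_pos
  have ht := R.t_pos
  have hκ := R.κ_pos
  have hμ := R.μ_nonneg
  have hν := R.ν_nonneg
  have hcB : (0 : ℝ) < #B := by exact_mod_cast hBne.card_pos
  set θ : ℝ := R.t ^ #T * R.κ ^ #S * #B with hθ
  have hθ0 : 0 < θ := by positivity
  rcases le_total (#S) (2 * #T) with hle | hle
  · rw [filter_false_of_mem]
    · simp; positivity
    · rintro x - ⟨y₀, hy₀⟩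
      refine absurd hy₀ (not_lt.mpr ?_)
      calc |∑ y ∈ fiber B T y₀, gadgetSign S x y|
          ≤ ∑ y ∈ fiber B T y₀, |gadgetSign S x y| := abs_sum_le_sum_abs _ _
        _ = #(fiber B T y₀) := by simp [abs_gadgetSign]
        _ ≤ R.r₁ ^ #T * #B := hB T hT y₀
        _ ≤ (R.t * R.κ ^ 2) ^ #T * #B := by gcongr; exact R.r₁_le
        _ = R.t ^ #T * R.κ ^ (2 * #T) * #B := by rw [mul_pow, ← pow_mul]
        _ ≤ θ := by
          rw [hθ]
          gcongr ?_ * ?_ * _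
          exact pow_le_pow_of_le_one hκ.le R.κ_le hle
  · set F : (Fin n → Fin b → Bit) → (Fin n → Fin b → Bit) → ℝ :=
      fun x y₀ => ∑ y ∈ fiber B T y₀, gadgetSign S x y with hF
    set D := A.filter fun x => ∃ y₀, θ < |F x y₀| with hD
    set C : ℝ := R.r₂ ^ #S * #A * (R.r₁ ^ (#S + #T) * #B) * ((2 : ℝ) ^ b) ^ #S with hC
    have hfib : ∀ y₀ ∈ B, (0 : ℝ) < #(fiber B T y₀) := fun y₀ hy₀ => by
      exact_mod_cast card_pos.mpr ⟨y₀, mem_fiber.mpr ⟨hy₀, fun _ _ => rfl⟩⟩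
    have h1 : ∀ y₀, ∑ x ∈ A, F x y₀ ^ 2 ≤ C * #(fiber B T y₀) := by
      intro y₀
      have := sum_sq_gadgetSign_le A (fiber B T y₀) S (R.r₂ ^ #S * #A)
        (R.r₁ ^ (#S + #T) * #B) (hA S hS) (fun y => by
          rw [fiber_piecewise B hST.symm]
          refine (hB (T ∪ S) (union_subset hT hS) _).trans_eq ?_
          rw [card_union_of_disjoint hST.symm, add_comm]) (fun _ => 1)
      simpa [hF, hC] using this
    -- Dividing by the fiber size makes the sum over `y₀ ∈ B` count each pattern on `T` once.
    -- Markov's inequality thus treats all patterns together, with no union bound over them.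
    have h2 : ∀ x ∈ D, θ ^ 2 ≤ ∑ y₀ ∈ B, F x y₀ ^ 2 / #(fiber B T y₀) := by
      intro x hx
      obtain ⟨y₁, hy₁⟩ := (mem_filter.mp hx).2
      have hne : (fiber B T y₁).Nonempty := by
        rw [nonempty_iff_ne_empty]
        intro he
        rw [hF] at hy₁
        simp only [he, sum_empty, abs_zero] at hy₁
        exact absurd hy₁ (not_lt.mpr hθ0.le)
      have hpos : (0 : ℝ) < #(fiber B T y₁) := by exact_mod_cast hne.card_pos
      calc θ ^ 2 ≤ F x y₁ ^ 2 := by rw [← sq_abs (F x y₁)]; gcongr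
        _ = ∑ y₀ ∈ fiber B T y₁, F x y₁ ^ 2 / #(fiber B T y₁) := by
          rw [sum_const, nsmul_eq_mul]; field_simp
        _ = ∑ y₀ ∈ fiber B T y₁, F x y₀ ^ 2 / #(fiber B T y₀) :=
          sum_congr rfl fun y₀ hy₀ => by simp only [hF, fiber_congr hy₀]
        _ ≤ _ := sum_le_sum_of_subset_of_nonneg (fiber_subset _ _ _)
          fun _ _ _ => by positivity
    have h3 : #D * θ ^ 2 ≤ C * #B := by
      calc #D * θ ^ 2 ≤ ∑ x ∈ D, ∑ y₀ ∈ B, F x y₀ ^ 2 / #(fiber B T y₀) := by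
            rw [← nsmul_eq_mul]; exact card_nsmul_le_sum _ _ _ h2
        _ ≤ ∑ x ∈ A, ∑ y₀ ∈ B, F x y₀ ^ 2 / #(fiber B T y₀) :=
          sum_le_sum_of_subset_of_nonneg (filter_subset _ _)
            fun _ _ _ => sum_nonneg fun _ _ => by positivity
        _ = ∑ y₀ ∈ B, (∑ x ∈ A, F x y₀ ^ 2) / #(fiber B T y₀) := by
          rw [sum_comm]; simp_rw [sum_div]
        _ ≤ ∑ y₀ ∈ B, C := sum_le_sum fun y₀ hy₀ => by
          rw [div_le_iff₀ (hfib y₀ hy₀)]; exact h1 y₀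
        _ = C * #B := by rw [sum_const, nsmul_eq_mul, mul_comm]
    have h4 : C * #B ≤ R.μ ^ #S * R.ν ^ #T * #A * θ ^ 2 := by
      calc C * #B = ((R.r₂ * R.r₁ * 2 ^ b) ^ #S * R.r₁ ^ #T) * (#A * #B ^ 2) := by
            rw [hC, mul_pow, mul_pow, pow_add]; ring
        _ ≤ (R.μ ^ #S * R.ν ^ #T * (R.t ^ #T * R.κ ^ #S) ^ 2) * (#A * #B ^ 2) := by
            exact mul_le_mul_of_nonneg_right (R.moment_pow_le hle) (by positivity)
        _ = _ := by rw [hθ]; ring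
    exact le_of_mul_le_mul_right (h3.trans h4) (by positivity)

/-- At least half of a dense set is safe for a dense set. -/
lemma exists_safe_half (R : Rates n b) {J : Finset (Fin n)}
    {A B : Finset (Fin n → Fin b → Bit)} (hA : Dense R.r₂ J A) (hB : Dense R.r₁ J B)
    (hBne : B.Nonempty) :
    ∃ A' ⊆ A, (#A : ℝ) ≤ 2 * #A' ∧ ∀ x ∈ A', Safe R J B x := by
  classical
  have hμ := R.μ_nonneg
  have hν := R.ν_nonneg
  refine ⟨A.filter (Safe R J B), filter_subset _ _, ?_, fun x hx => (mem_filter.mp hx).2⟩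
  set D : Finset (Fin n) × Finset (Fin n) → Finset (Fin n → Fin b → Bit) := fun p =>
    A.filter fun x => ∃ y₀, R.t ^ #p.2 * R.κ ^ #p.1 * #B <
      |∑ y ∈ fiber B p.2 y₀, gadgetSign p.1 x y| with hD
  set Q : Finset (Finset (Fin n) × Finset (Fin n)) :=
    univ.filter fun p => p.1 ⊆ J ∧ p.1.Nonempty ∧ p.2 ⊆ J ∧ Disjoint p.1 p.2 with hQ
  have hsub : A.filter (fun x => ¬ Safe R J B x) ⊆ Q.biUnion D := by
    intro x hx
    obtain ⟨hxA, hx⟩ := mem_filter.mp hx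
    unfold Safe at hx
    push Not at hx
    obtain ⟨S, hS, hne, T, hT, hST, y₀, hy₀⟩ := hx
    refine mem_biUnion.mpr ⟨(S, T), ?_, ?_⟩
    · simp [hQ, hS, hne, hT, hST]
    · exact mem_filter.mpr ⟨hxA, y₀, hy₀⟩
  have hbad : (#(A.filter fun x => ¬ Safe R J B x) : ℝ) ≤ 1 / 2 * #A := by
    calc (#(A.filter fun x => ¬ Safe R J B x) : ℝ) ≤ #(Q.biUnion D) := by
          exact_mod_cast card_le_card hsub
      _ ≤ ∑ p ∈ Q, (#(D p) : ℝ) := by exact_mod_cast card_biUnion_le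
      _ ≤ ∑ p ∈ Q, R.μ ^ #p.1 * R.ν ^ #p.2 * #A := by
          refine sum_le_sum fun p hp => ?_
          obtain ⟨h1, -, h3, h4⟩ := (mem_filter.mp hp).2
          exact card_unbalanced_le R hA hB hBne h1 h3 h4
      _ ≤ ∑ p ∈ (univ.erase ∅ : Finset (Finset (Fin n))) ×ˢ (univ : Finset (Finset (Fin n))),
            R.μ ^ #p.1 * R.ν ^ #p.2 * #A := by
          refine sum_le_sum_of_subset_of_nonneg ?_ fun _ _ _ => by positivity
          intro p hp
          obtain ⟨-, h2, -, -⟩ := (mem_filter.mp hp).2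
          simp [h2.ne_empty]
      _ = ((1 + R.μ) ^ n - 1) * (1 + R.ν) ^ n * #A := by
          rw [← sum_pow_card, ← sum_pow_card,
            ← add_sum_erase univ (fun S : Finset (Fin n) => R.μ ^ #S) (mem_univ ∅)]
          simp only [card_empty, pow_zero, add_sub_cancel_left]
          rw [sum_mul_sum, ← sum_product', sum_mul]
      _ ≤ 1 / 2 * #A := by gcongr; exact R.union_le
  have hsum : (#(A.filter (Safe R J B)) : ℝ) + #(A.filter fun x => ¬ Safe R J B x) = #A := by
    exact_mod_cast card_filter_add_card_filter_not (s := A) (Safe R J B)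
  linarith

/-- The points of `B` whose gadget values with `x` on `I` are prescribed by `z`. -/
def gadgetFiber (B : Finset (Fin n → Fin b → Bit)) (I : Finset (Fin n))
    (x : Fin n → Fin b → Bit) (z : Fin n → Bit) : Finset (Fin n → Fin b → Bit) :=
  B.filter fun y => ∀ i ∈ I, innerProductGadget (x i) (y i) = z i

/-- Expanding the indicator of the gadget values into characters on `I`, the empty set gives the
main term; safety bounds the others by a geometric sum, at most half the scale. -/
lemma abs_card_gadgetFiber_sub_le (R : Rates n b) {J I T : Finset (Fin n)}
    {B : Finset (Fin n → Fin b → Bit)} {x : Fin n → Fin b → Bit} (hx : Safe R J B x)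
    (hI : I ⊆ J) (hT : T ⊆ J) (hIT : Disjoint I T) (z : Fin n → Bit) (y₀ : Fin n → Fin b → Bit) :
    |2 ^ #I * (#(gadgetFiber (fiber B T y₀) I x z) : ℝ) - #(fiber B T y₀)| ≤
      R.t ^ #T * #B / 2 := by
  have ht := R.t_pos
  have hκ := R.κ_pos
  have h1 : 2 ^ #I * (#(gadgetFiber (fiber B T y₀) I x z) : ℝ) =
      ∑ S ∈ I.powerset, character S z * ∑ y ∈ fiber B T y₀, gadgetSign S x y := by
    simp_rw [mul_sum]
    rw [sum_comm, gadgetFiber, card_filter]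
    push_cast
    rw [mul_sum]
    refine sum_congr rfl fun y _ => ?_
    have := sum_powerset_character_mul_character I z fun i => innerProductGadget (x i) (y i)
    simp only [gadgetSign]
    rw [this]
    by_cases h : ∀ i ∈ I, innerProductGadget (x i) (y i) = z i
    · rw [if_pos h, if_pos fun i hi => (h i hi).symm]; simp
    · rw [if_neg h, if_neg fun h' => h fun i hi => (h' i hi).symm]; simp
  have h2 : ∑ S ∈ I.powerset, character S z * ∑ y ∈ fiber B T y₀, gadgetSign S x y -
      #(fiber B T y₀) = ∑ S ∈ I.powerset.erase ∅,
        character S z * ∑ y ∈ fiber B T y₀, gadgetSign S x y := by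
    rw [← add_sum_erase I.powerset _ (empty_mem_powerset I)]
    simp [gadgetSign, character]
  rw [h1, h2]
  calc |∑ S ∈ I.powerset.erase ∅, character S z * ∑ y ∈ fiber B T y₀, gadgetSign S x y|
      ≤ ∑ S ∈ I.powerset.erase ∅, |character S z * ∑ y ∈ fiber B T y₀, gadgetSign S x y| :=
        abs_sum_le_sum_abs _ _
    _ ≤ ∑ S ∈ I.powerset.erase ∅, R.κ ^ #S * (R.t ^ #T * #B) := by
        refine sum_le_sum fun S hS => ?_
        obtain ⟨hne, hSI⟩ := mem_erase.mp hS
        rw [mem_powerset] at hSI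
        rw [abs_mul, abs_character, one_mul]
        refine (hx S (hSI.trans hI) (nonempty_iff_ne_empty.mpr hne) T hT
          (disjoint_of_subset_left hSI hIT) y₀).trans_eq ?_
        ring
    _ ≤ ∑ S ∈ univ.erase ∅, R.κ ^ #S * (R.t ^ #T * #B) :=
        sum_le_sum_of_subset_of_nonneg (erase_subset_erase _ (subset_univ _))
          fun _ _ _ => by positivity
    _ = ((1 + R.κ) ^ n - 1) * (R.t ^ #T * #B) := by
        rw [← sum_mul, ← sum_pow_card,
          ← add_sum_erase univ (fun S : Finset (Fin n) => R.κ ^ #S) (mem_univ ∅)]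
        simp
    _ ≤ 1 / 2 * (R.t ^ #T * #B) := by gcongr; exact R.correlation_le
    _ = _ := by ring

lemma card_le_card_gadgetFiber (R : Rates n b) {J I : Finset (Fin n)}
    {B : Finset (Fin n → Fin b → Bit)} {x : Fin n → Fin b → Bit} (hx : Safe R J B x)
    (hI : I ⊆ J) (z : Fin n → Bit) :
    (#B : ℝ) ≤ 2 ^ (#I + 1) * #(gadgetFiber B I x z) := by
  have h := abs_card_gadgetFiber_sub_le R hx hI (empty_subset J) (disjoint_empty_right I) z x
  rw [fiber_empty, card_empty, pow_zero, one_mul] at h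
  rw [pow_succ]
  linarith [(abs_le.mp h).1]

/-- Safety on subcubes bounds a pattern on `T` inside the cut by `3/2 * t ^ |T|` times `|B| / 2 ^
|I|`, while the cut has at least half of `|B| / 2 ^ |I|` points. The resulting factor 3 is absorbed
by `3 * t ≤ r₂`, as `T` is nonempty. -/
lemma dense_gadgetFiber (R : Rates n b) {J I : Finset (Fin n)}
    {B : Finset (Fin n → Fin b → Bit)} (hB : Dense R.r₁ J B) {x : Fin n → Fin b → Bit}
    (hx : Safe R J B x) (hI : I ⊆ J) (z : Fin n → Bit) :
    Dense R.r₂ (J \ I) (gadgetFiber B I x z) := by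
  intro T hT y₀
  have ht := R.t_pos
  have hr := R.r₁_pos
  rcases T.eq_empty_or_nonempty with rfl | hne
  · simp
  have hTJ : T ⊆ J := hT.trans sdiff_subset
  have hIT : Disjoint I T := disjoint_of_subset_right hT disjoint_sdiff
  have h1 := (abs_le.mp (abs_card_gadgetFiber_sub_le R hx hI hTJ hIT z y₀)).2
  have h2 := hB T hTJ y₀
  have h3 := card_le_card_gadgetFiber R hx hI z
  have h4 : R.r₁ ^ #T ≤ R.t ^ #T := by gcongr; exact R.r₁_le_t
  have h5 : 3 * R.t ^ #T ≤ R.r₂ ^ #T := by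
    calc 3 * R.t ^ #T ≤ 3 ^ #T * R.t ^ #T := by
          gcongr
          exact le_self_pow₀ (by norm_num) hne.card_pos.ne'
      _ = (3 * R.t) ^ #T := by rw [mul_pow]
      _ ≤ R.r₂ ^ #T := by gcongr; exact R.three_t
  have h6 : fiber (gadgetFiber B I x z) T y₀ = gadgetFiber (fiber B T y₀) I x z := by
    unfold fiber gadgetFiber
    rw [filter_comm]
  rw [h6]
  have h7 : (2 : ℝ) ^ #I * #(gadgetFiber (fiber B T y₀) I x z) ≤
      2 ^ #I * (R.r₂ ^ #T * #(gadgetFiber B I x z)) := by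
    calc (2 : ℝ) ^ #I * #(gadgetFiber (fiber B T y₀) I x z)
        ≤ R.r₁ ^ #T * #B + R.t ^ #T * #B / 2 := by linarith
      _ ≤ R.t ^ #T * #B + R.t ^ #T * #B / 2 := by gcongr
      _ = 3 * R.t ^ #T * #B / 2 := by ring
      _ ≤ R.r₂ ^ #T * #B / 2 := by gcongr
      _ ≤ R.r₂ ^ #T * (2 ^ (#I + 1) * #(gadgetFiber B I x z)) / 2 := by
          have := R.r₂_pos
          gcongr
      _ = _ := by rw [pow_succ]; ring
  exact le_of_mul_le_mul_left h7 (by positivity)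

/-- Marginalising over `I` and passing to a subset. -/
lemma Spread.sdiff {φ : ℝ} {J I : Finset (Fin n)} {B B' : Finset (Fin n → Fin b → Bit)}
    (h : Spread φ J B) (hB : B.Nonempty) (hI : I ⊆ J) (hB' : B' ⊆ B) {c : ℝ}
    (hc : (#B : ℝ) ≤ c * #B') : Spread (c * φ) (J \ I) B' := by
  refine Spread.mono_set (A := B) (fun x => ?_) hB hB' hc
  have hφ := h.one_le hB
  set Z : ℝ := ((2 : ℝ) ^ b) ^ #J with hZ
  have hZ0 : 0 < Z := by positivity
  have hcard : #I + #(J \ I) = #J := by rw [add_comm, card_sdiff_add_card_eq_card hI]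
  have hM : ∀ x', (#(fiber (fiber B (J \ I) x) I x') : ℝ) ≤ φ * #B / Z := by
    intro x'
    rw [fiber_piecewise B sdiff_disjoint, sdiff_union_of_subset hI, le_div_iff₀ hZ0]
    exact h _
  have h1 := sum_le_of_fiber_le (fiber B (J \ I) x) I (φ * #B / Z) hM
    (fun _ => 1) (fun _ => zero_le_one) (fun _ _ _ => rfl)
  simp only [sum_const, nsmul_eq_mul, mul_one, card_univ, Fintype.card_fun, Fintype.card_fin,
    ZMod.card, Nat.cast_pow, Nat.cast_ofNat] at h1
  have h2 := le_of_mul_le_mul_right h1 (by positivity)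
  calc (#(fiber B (J \ I) x) : ℝ) * ((2 : ℝ) ^ b) ^ #(J \ I)
      ≤ φ * #B / Z * ((2 : ℝ) ^ b) ^ #I * ((2 : ℝ) ^ b) ^ #(J \ I) := by gcongr
    _ = φ * #B / Z * Z := by rw [mul_assoc, ← pow_add, hcard]
    _ = φ * #B := div_mul_cancel₀ _ hZ0.ne'

/-- Fixing the coordinates in `I` to a value of high frequency. -/
lemma Spread.fiber_of_le {φ r : ℝ} (hr : 0 < r) {J I : Finset (Fin n)}
    {A : Finset (Fin n → Fin b → Bit)} (h : Spread φ J A) (hA : A.Nonempty) (hI : I ⊆ J)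
    {a : Fin n → Fin b → Bit} (ha : r ^ #I * #A ≤ (#(fiber A I a) : ℝ)) :
    Spread (φ / (r * 2 ^ b) ^ #I) (J \ I) (fiber A I a) := by
  intro x
  have hφ := h.one_le hA
  have hcard : #J = #I + #(J \ I) := by rw [add_comm, card_sdiff_add_card_eq_card hI]
  have h1 := h (I.piecewise a x)
  rw [fiber_piecewise A disjoint_sdiff, union_sdiff_of_subset hI]
  rw [div_mul_eq_mul_div, le_div_iff₀ (by positivity)]
  calc (#(fiber A J (I.piecewise a x)) : ℝ) * ((2 : ℝ) ^ b) ^ #(J \ I) * (r * 2 ^ b) ^ #I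
      = r ^ #I * (#(fiber A J (I.piecewise a x)) * ((2 : ℝ) ^ b) ^ #J) := by
        rw [hcard, pow_add, mul_pow]; ring
    _ ≤ r ^ #I * (φ * #A) := by gcongr
    _ = φ * (r ^ #I * #A) := by ring
    _ ≤ φ * #(fiber A I a) := by gcongr

/-- Fixing a maximal pattern of high frequency makes the remaining coordinates dense. -/
lemma exists_dense_fiber {r : ℝ} (hr : 0 < r) (J : Finset (Fin n))
    (A : Finset (Fin n → Fin b → Bit)) :
    ∃ I ⊆ J, ∃ a, r ^ #I * #A ≤ (#(fiber A I a) : ℝ) ∧ Dense r (J \ I) (fiber A I a) := by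
  classical
  -- The empty set always qualifies. A pattern on `S` violating density in the fiber would extend
  -- `I`, so maximality forces `S = ∅`, where the violation is a strict self-inequality.
  obtain ⟨I, hI, hmax⟩ := exists_max_image
    (J.powerset.filter fun I => ∃ a, r ^ #I * #A ≤ (#(fiber A I a) : ℝ)) card
    ⟨∅, by simp⟩
  obtain ⟨hIJ, a, ha⟩ := mem_filter.mp hI
  rw [mem_powerset] at hIJ
  refine ⟨I, hIJ, a, ha, fun S hS x => ?_⟩
  by_contra hcon
  push Not at hcon
  have hdisj : Disjoint I S := disjoint_of_subset_right hS disjoint_sdiff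
  rw [fiber_piecewise A hdisj] at hcon
  have hmem : I ∪ S ∈ J.powerset.filter fun I => ∃ a, r ^ #I * #A ≤ (#(fiber A I a) : ℝ) := by
    refine mem_filter.mpr ⟨mem_powerset.mpr (union_subset hIJ (hS.trans sdiff_subset)),
      I.piecewise a x, ?_⟩
    refine le_trans ?_ hcon.le
    rw [card_union_of_disjoint hdisj, pow_add, mul_comm (r ^ #I), mul_assoc]
    gcongr
  have hle := hmax _ hmem
  rw [card_union_of_disjoint hdisj] at hle
  have hS0 : S = ∅ := card_eq_zero.mp (by omega)
  subst hS0
  have heq : I ∪ ∅ = I := union_empty I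
  rw [heq, card_empty, pow_zero, one_mul] at hcon
  have h2 : fiber A I (I.piecewise a x) = fiber A I a := by
    ext w
    simp only [mem_fiber, and_congr_right_iff]
    intro _
    exact forall₂_congr fun i hi => by rw [piecewise_eq_of_mem _ _ _ hi]
  rw [h2] at hcon
  exact lt_irrefl _ hcon

/-- The density restoration step: the side `A` becomes `r₁`-dense, possibly after fixing a set `I`
of coordinates, in which case the other side can be adapted to all gadget values on `I`. -/
theorem restore_density_step (R : Rates n b) {J : Finset (Fin n)}
    {A B : Finset (Fin n → Fin b → Bit)} (hA : Dense R.r₂ J A) (hB : Dense R.r₁ J B)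
    (hAne : A.Nonempty) (hBne : B.Nonempty) {φA φB : ℝ} (hφA : Spread φA J A)
    (hφB : Spread φB J B) :
    (∃ A' ⊆ A, A'.Nonempty ∧ Dense R.r₁ J A' ∧ Spread (2 * φA) J A') ∨
    ∃ I ⊆ J, I.Nonempty ∧ ∃ (a : Fin n → Fin b → Bit) (φ : ℝ), ∃ A' ⊆ A, A'.Nonempty ∧
      Dense R.r₁ (J \ I) A' ∧ Spread φ (J \ I) A' ∧ (∀ x ∈ A', ∀ i ∈ I, x i = a i) ∧
      ∀ z : Fin n → Bit, ∃ (φ' : ℝ), ∃ B' ⊆ B, B'.Nonempty ∧ Dense R.r₂ (J \ I) B' ∧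
        Spread φ' (J \ I) B' ∧ (∀ y ∈ B', ∀ i ∈ I, innerProductGadget (a i) (y i) = z i) ∧
        φ * φ' * (R.r₁ * 2 ^ b / 8) ^ #I ≤ φA * φB := by
  have hr := R.r₁_pos
  obtain ⟨A₁, hA₁A, hhalf, hsafe⟩ := exists_safe_half R hA hB hBne
  have hA₁ne : A₁.Nonempty := by
    rw [← card_pos]
    have : (0 : ℝ) < #A := by exact_mod_cast hAne.card_pos
    have : (0 : ℝ) < #A₁ := by linarith
    exact_mod_cast this
  have hφA₁ : Spread (2 * φA) J A₁ := hφA.mono_set hAne hA₁A hhalf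
  obtain ⟨I, hIJ, a, ha, hdense⟩ := exists_dense_fiber hr J A₁
  rcases I.eq_empty_or_nonempty with rfl | hIne
  · left
    rw [fiber_empty, sdiff_empty] at hdense
    exact ⟨A₁, hA₁A, hA₁ne, hdense, hφA₁⟩
  right
  have hfne : (fiber A₁ I a).Nonempty := by
    rw [← card_pos]
    have h1 : (0 : ℝ) < #A₁ := by exact_mod_cast hA₁ne.card_pos
    have h2 : (0 : ℝ) < #(fiber A₁ I a) := lt_of_lt_of_le (by positivity) ha
    exact_mod_cast h2
  refine ⟨I, hIJ, hIne, a, _, fiber A₁ I a, (fiber_subset _ _ _).trans hA₁A, hfne, hdense,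
    hφA₁.fiber_of_le hr hA₁ne hIJ ha, fun x hx => (mem_fiber.mp hx).2, fun z => ?_⟩
  obtain ⟨x₀, hx₀⟩ := hfne
  obtain ⟨hx₀A, hx₀a⟩ := mem_fiber.mp hx₀
  have hx₀s := hsafe x₀ hx₀A
  have hcard := card_le_card_gadgetFiber R hx₀s hIJ z
  refine ⟨2 ^ (#I + 1) * φB, gadgetFiber B I x₀ z, filter_subset _ _, ?_,
    dense_gadgetFiber R hB hx₀s hIJ z, hφB.sdiff hBne hIJ (filter_subset _ _) hcard, ?_, ?_⟩
  · rw [← card_pos]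
    have h1 : (0 : ℝ) < #B := by exact_mod_cast hBne.card_pos
    have h2 : (0 : ℝ) < #(gadgetFiber B I x₀ z) :=
      pos_of_mul_pos_right (h1.trans_le hcard) (by positivity)
    exact_mod_cast h2
  · intro y hy i hi
    rw [← hx₀a i hi]
    exact (mem_filter.mp hy).2 i hi
  · have hpA := hφA.one_le hAne
    have hpB := hφB.one_le hBne
    -- Halving `A` and cutting `B` cost `2 * 2 ^ (|I| + 1)`, which is at most `8 ^ |I|` because `I`
    -- is nonempty: the queries pay for both.
    have h4 : (4 : ℝ) ≤ 4 ^ #I := le_self_pow₀ (by norm_num) hIne.card_pos.ne'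
    have h8 : (8 : ℝ) ^ #I = 2 ^ #I * 4 ^ #I := by rw [← mul_pow]; norm_num
    have h5 : 2 * φA / (R.r₁ * 2 ^ b) ^ #I * (2 ^ (#I + 1) * φB) * (R.r₁ * 2 ^ b / 8) ^ #I =
        φA * φB * (4 / 4 ^ #I) := by
      rw [div_pow, h8, pow_succ]
      field_simp
      ring
    rw [h5]
    have h6 : (4 : ℝ) / 4 ^ #I ≤ 1 := by rw [div_le_one (by positivity)]; exact h4
    have h7 : 0 ≤ φA * φB := by positivity
    nlinarith

end Density

/-! ### Building the decision tree -/

section Trees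

variable {n : ℕ}

/-- Some tree of depth at most `k` leads from every input that agrees with `z` off `J` to a set of
unqueried coordinates in `J` with the property `L`. -/
def Reachable (L : Finset (Fin n) → (Fin n → Bit) → Prop) (k : ℕ) (J : Finset (Fin n))
    (z : Fin n → Bit) : Prop :=
  ∃ T : DecisionTree n, T.depth ≤ k ∧
    ∀ x : Fin n → Bit, (∀ i ∉ J, x i = z i) → L (J \ T.queried x) x

variable {L : Finset (Fin n) → (Fin n → Bit) → Prop}

lemma Reachable.leaf {k : ℕ} {J : Finset (Fin n)} {z : Fin n → Bit}
    (h : ∀ x : Fin n → Bit, (∀ i ∉ J, x i = z i) → L J x) : Reachable L k J z :=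
  ⟨.leaf, Nat.zero_le k, fun x hx => by simpa [DecisionTree.queried] using h x hx⟩

lemma Reachable.query {k : ℕ} {J : Finset (Fin n)} {z : Fin n → Bit} (i : Fin n)
    (h : ∀ v, Reachable L k (J.erase i) (Function.update z i v)) : Reachable L (k + 1) J z := by
  choose T hT hL using h
  refine ⟨.query i T, ?_, fun x hx => ?_⟩
  · rw [DecisionTree.depth]
    exact Nat.succ_le_succ (max_le (hT 0) (hT 1))
  · have h1 := hL (x i) x fun j hj => by
      by_cases hji : j = i
      · subst hji; simp
      · rw [Function.update_of_ne hji]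
        exact hx j fun hjJ => hj (mem_erase.mpr ⟨hji, hjJ⟩)
    have h2 : J \ (DecisionTree.query i T).queried x = J.erase i \ (T (x i)).queried x := by
      ext j
      simp only [DecisionTree.queried, mem_sdiff, mem_insert, mem_erase]
      tauto
    rwa [h2]

lemma Reachable.query_set {k : ℕ} (I : Finset (Fin n)) : ∀ {J : Finset (Fin n)} {z : Fin n → Bit},
    (∀ z' : Fin n → Bit, (∀ i ∉ I, z' i = z i) → Reachable L k (J \ I) z') →
      Reachable L (k + #I) J z := by
  induction I using Finset.induction_on with
  | empty =>
    intro J z h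
    simpa using h z fun _ _ => rfl
  | insert i I hi ih =>
    intro J z h
    rw [card_insert_of_notMem hi, ← add_assoc]
    refine Reachable.query i fun v => ih fun z' hz' => ?_
    have h1 : J.erase i \ I = J \ insert i I := by
      ext j
      simp only [mem_sdiff, mem_insert, mem_erase]
      tauto
    rw [h1]
    refine h z' fun j hj => ?_
    rw [mem_insert, not_or] at hj
    rw [hz' j hj.2, Function.update_of_ne hj.1]

end Trees

/-! ### Structured rectangles -/

section Structured

variable {n b : ℕ}

/-- A rectangle whose sides are dense on `J` and on which the gadget takes the values `z` off `J`;
the number `Φ` bounds the product of the spreads of the sides. -/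
structure Structured (rA rB Φ : ℝ) (J : Finset (Fin n)) (z : Fin n → Bit)
    (A B : Finset (Fin n → Fin b → Bit)) : Prop where
  nonempty_left : A.Nonempty
  nonempty_right : B.Nonempty
  dense_left : Dense rA J A
  dense_right : Dense rB J B
  gadget_eq : ∀ x ∈ A, ∀ y ∈ B, ∀ i ∉ J, innerProductGadget (x i) (y i) = z i
  spread : ∃ φA φB, Spread φA J A ∧ Spread φB J B ∧ φA * φB ≤ Φ

lemma Structured.symm {rA rB Φ : ℝ} {J : Finset (Fin n)} {z : Fin n → Bit}
    {A B : Finset (Fin n → Fin b → Bit)} (h : Structured rA rB Φ J z A B) :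
    Structured rB rA Φ J z B A where
  nonempty_left := h.nonempty_right
  nonempty_right := h.nonempty_left
  dense_left := h.dense_right
  dense_right := h.dense_left
  gadget_eq := fun x hx y hy i hi => by
    rw [innerProductGadget_comm]; exact h.gadget_eq y hy x hx i hi
  spread := by
    obtain ⟨φA, φB, h1, h2, h3⟩ := h.spread
    exact ⟨φB, φA, h2, h1, by rwa [mul_comm]⟩

lemma Structured.one_le {rA rB Φ : ℝ} {J : Finset (Fin n)} {z : Fin n → Bit}
    {A B : Finset (Fin n → Fin b → Bit)} (h : Structured rA rB Φ J z A B) : 1 ≤ Φ := by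
  obtain ⟨φA, φB, h1, h2, h3⟩ := h.spread
  exact (one_le_mul_of_one_le_of_one_le (h1.one_le h.nonempty_left)
    (h2.one_le h.nonempty_right)).trans h3

lemma structured_univ {r : ℝ} (hr : 1 ≤ r * 2 ^ b) (z : Fin n → Bit) :
    Structured r r 1 (univ : Finset (Fin n)) z (univ : Finset (Fin n → Fin b → Bit))
      (univ : Finset (Fin n → Fin b → Bit)) := by
  have hc : ∀ (S : Finset (Fin n)) (x : Fin n → Fin b → Bit),
      ((2 : ℝ) ^ b) ^ #S * #(fiber univ S x) = #(univ : Finset (Fin n → Fin b → Bit)) := by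
    intro S x
    have := card_fiber_univ S x
    simp only [Fintype.card_fin] at this
    simp only [card_univ, Fintype.card_fun, Fintype.card_fin, ZMod.card]
    exact_mod_cast this
  have hd : Dense r (univ : Finset (Fin n)) (univ : Finset (Fin n → Fin b → Bit)) := by
    intro S _ x
    rw [← hc S x, ← mul_assoc, ← mul_pow]
    exact le_mul_of_one_le_left (by positivity) (one_le_pow₀ hr)
  have hs : Spread 1 (univ : Finset (Fin n)) (univ : Finset (Fin n → Fin b → Bit)) :=
    fun x => by rw [one_mul, ← hc univ x, mul_comm]
  exact ⟨univ_nonempty, univ_nonempty, hd, hd, fun x _ y _ i hi => absurd (mem_univ i) hi,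
    1, 1, hs, hs, by norm_num⟩

lemma Structured.half (R : Rates n b) {Φ : ℝ} {J : Finset (Fin n)} {z : Fin n → Bit}
    {A A' B : Finset (Fin n → Fin b → Bit)} (h : Structured R.r₁ R.r₁ Φ J z A B)
    (hA' : A' ⊆ A) (hc : #A ≤ 2 * #A') : Structured R.r₂ R.r₁ (2 * Φ) J z A' B where
  nonempty_left := by
    have := h.nonempty_left.card_pos
    rw [← card_pos]
    omega
  nonempty_right := h.nonempty_right
  dense_left := h.dense_left.of_half R.r₁_pos.le R.two_r₁ hA' (by exact_mod_cast hc)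
  dense_right := h.dense_right
  gadget_eq := fun x hx => h.gadget_eq x (hA' hx)
  spread := by
    obtain ⟨φA, φB, h1, h2, h3⟩ := h.spread
    exact ⟨2 * φA, φB, h1.mono_set h.nonempty_left hA' (by exact_mod_cast hc), h2, by linarith⟩

/-- Restoring the density of both sides by queries, with the two sides taking turns. -/
theorem reachable_of_restored (R : Rates n b) {L : Finset (Fin n) → (Fin n → Bit) → Prop} {C : ℝ}
    (hC : 1 ≤ C) (hρ : 1 ≤ R.r₁ * 2 ^ b / 8) (N : ℕ) :
    ∀ (A₀ B₀ : Finset (Fin n → Fin b → Bit)),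
      (∀ Φ J z A B k, A ⊆ A₀ → B ⊆ B₀ → Structured R.r₁ R.r₁ Φ J z A B →
        Φ * C < (R.r₁ * 2 ^ b / 8) ^ (k + 1) → Reachable L k J z) →
      ∀ Φ J z A B k, #J ≤ N → A ⊆ A₀ → B ⊆ B₀ → Structured R.r₂ R.r₁ Φ J z A B →
        2 * Φ * C < (R.r₁ * 2 ^ b / 8) ^ (k + 1) → Reachable L k J z := by
  -- `N` bounds `|J|`, which shrinks at every turn that queries. `A₀` and `B₀` keep the facts
  -- already known about the transcript, `C` is reserved for later bits, and the factor 2 pays for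
  -- the one halving not followed by queries.
  induction N with
  | zero =>
    intro A₀ B₀ H Φ J z A B k hJ hA hB hst hk
    have hJ0 : J = ∅ := card_eq_zero.mp (by omega)
    subst hJ0
    refine H (2 * Φ) ∅ z A B k hA hB ⟨hst.nonempty_left, hst.nonempty_right, ?_,
      hst.dense_right, hst.gadget_eq, ?_⟩ hk
    · intro S hS x
      rw [subset_empty.mp hS]
      simp
    · obtain ⟨φA, φB, h1, h2, h3⟩ := hst.spread
      exact ⟨φA, φB, h1, h2, by linarith [hst.one_le]⟩
  | succ N ih =>
    intro A₀ B₀ H Φ J z A B k hJ hA hB hst hk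
    obtain ⟨φA, φB, hφA, hφB, hΦ⟩ := hst.spread
    rcases restore_density_step R hst.dense_left hst.dense_right hst.nonempty_left
      hst.nonempty_right hφA hφB with ⟨A', hA', hne, hd, hs⟩ |
      ⟨I, hIJ, hIne, a, φ, A', hA', hne, hd, hs, ha, hz⟩
    · exact H (2 * Φ) J z A' B k (hA'.trans hA) hB ⟨hne, hst.nonempty_right, hd,
        hst.dense_right, fun x hx => hst.gadget_eq x (hA' hx),
        2 * φA, φB, hs, hφB, by linarith⟩ hk
    · set ρ : ℝ := R.r₁ * 2 ^ b / 8 with hρdef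
      have hstruct : ∀ z' : Fin n → Bit, (∀ i ∉ I, z' i = z i) → ∃ (Φ' : ℝ), ∃ B' ⊆ B,
          Structured R.r₁ R.r₂ Φ' (J \ I) z' A' B' ∧ Φ' * ρ ^ #I ≤ Φ := by
        intro z' hz'
        obtain ⟨φ', B', hB', hne', hd', hs', hg, hpot⟩ := hz z'
        refine ⟨φ * φ', B', hB', ⟨hne, hne', hd, hd', ?_, φ, φ', hs, hs', le_rfl⟩,
          hpot.trans hΦ⟩
        intro x hx y hy i hi
        by_cases hiI : i ∈ I
        · rw [ha x hx i hiI]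
          exact hg y hy i hiI
        · rw [hz' i hiI]
          exact hst.gadget_eq x (hA' hx) y (hB' hy) i fun hiJ => hi (mem_sdiff.mpr ⟨hiJ, hiI⟩)
      have hρ0 : 0 < ρ := by linarith
      have hbound : ∀ Φ' : ℝ, Φ' * ρ ^ #I ≤ Φ → 2 * Φ' * C * ρ ^ #I < ρ ^ (k + 1) := by
        intro Φ' h
        refine lt_of_le_of_lt ?_ hk
        nlinarith
      -- The potential stays at least 1, so a block of more than `k` coordinates would break the
      -- budget.
      have hIk : #I ≤ k := by
        obtain ⟨Φ', B', -, hs', hp⟩ := hstruct z fun _ _ => rfl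
        have h1 := hbound Φ' hp
        have h2 := hs'.one_le
        by_contra hlt
        push Not at hlt
        have h3 : ρ ^ (k + 1) ≤ ρ ^ #I := pow_le_pow_right₀ hρ hlt
        have h4 : 0 < ρ ^ #I := by positivity
        nlinarith [one_le_mul_of_one_le_of_one_le h2 hC]
      obtain ⟨l, rfl⟩ := Nat.exists_eq_add_of_le' hIk
      refine Reachable.query_set I fun z' hz' => ?_
      obtain ⟨Φ', B', hB', hs', hp⟩ := hstruct z' hz'
      have hlt : #(J \ I) ≤ N := by
        have h1 := card_sdiff_add_card_eq_card hIJ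
        have h2 := hIne.card_pos
        omega
      -- The sides swap roles: `A'` is now `r₁`-dense and `B'` only `r₂`-dense.
      refine ih B₀ A₀ (fun Φ J z A B k hA hB hst hk => H Φ J z B A k hB hA hst.symm hk)
        Φ' (J \ I) z' B' A' l hlt (hB'.trans hB) (hA'.trans hA) hs'.symm ?_
      have h1 := hbound Φ' hp
      rw [show l + #I + 1 = (l + 1) + #I by ring, pow_add] at h1
      exact lt_of_mul_lt_mul_right h1 (by positivity)

lemma exists_majority {X : Type*} (A : Finset X) (h : X → Bit) :
    ∃ v, #A ≤ 2 * #(A.filter fun x => h x = v) := by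
  classical
  have h1 := card_filter_add_card_filter_not (s := A) (fun x => h x = 0)
  have h2 : (A.filter fun x => ¬ h x = 0) = A.filter fun x => h x = 1 := by
    refine filter_congr fun x _ => ?_
    rcases bit_cases (h x) with hx | hx <;> simp [hx]
  rw [h2] at h1
  by_cases hle : #(A.filter fun x => h x = 1) ≤ #(A.filter fun x => h x = 0)
  · exact ⟨0, by omega⟩
  · exact ⟨1, by omega⟩

/-- The deterministic simulation: following the protocol from a structured rectangle on which the
transcript so far is constant. -/
theorem reachable_of_transcript (R : Rates n b) {L : Finset (Fin n) → (Fin n → Bit) → Prop}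
    (hρ : 1 ≤ R.r₁ * 2 ^ b / 8) {c : ℕ}
    (P : ClassicalProtocol (Fin n → Fin b → Bit) (Fin n → Fin b → Bit))
    (hL : ∀ Φ J z A B (τ : Fin c → Bit), Structured R.r₁ R.r₁ Φ J z A B →
      (∀ x ∈ A, ∀ y ∈ B, P.transcript x y c = τ) →
      ∀ x : Fin n → Bit, (∀ i ∉ J, x i = z i) → L J x) (m : ℕ) :
    ∀ (i : ℕ) (_ : i + m = c) (τ : Fin i → Bit) (Φ : ℝ) (J : Finset (Fin n)) (z : Fin n → Bit)
      (A B : Finset (Fin n → Fin b → Bit)) (k : ℕ), Structured R.r₁ R.r₁ Φ J z A B →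
      (∀ x ∈ A, ∀ y ∈ B, P.transcript x y i = τ) → Φ * 4 ^ m < (R.r₁ * 2 ^ b / 8) ^ (k + 1) →
      Reachable L k J z := by
  induction m with
  | zero =>
    intro i hi τ Φ J z A B k hst hτ _
    have hic : i = c := by omega
    subst hic
    exact Reachable.leaf (hL Φ J z A B τ hst hτ)
  | succ m ih =>
    intro i hi τ Φ J z A B k hst hτ hk
    have hC : (1 : ℝ) ≤ 4 ^ m := one_le_pow₀ (by norm_num)
    -- A bit costs 4: one factor 2 for the majority half, one for the final safe half.
    have hk' : 2 * (2 * Φ) * 4 ^ m < (R.r₁ * 2 ^ b / 8) ^ (k + 1) := by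
      rw [pow_succ] at hk
      linarith
    by_cases hev : Even i
    · obtain ⟨v, hv⟩ := exists_majority A fun x => P.alice i x τ
      refine reachable_of_restored R hC hρ (#J) (A.filter fun x => P.alice i x τ = v) B ?_
        (2 * Φ) J z _ B k le_rfl subset_rfl subset_rfl
        (hst.half R (filter_subset _ _) hv) hk'
      intro Φ' J' z' A' B' k' hA' hB' hst' hk''
      refine ih (i + 1) (by omega) (Fin.snoc (α := fun _ => Bit) τ v) Φ' J' z' A' B' k' hst' ?_ hk''
      intro x hx y hy
      obtain ⟨hxA, hxv⟩ := mem_filter.mp (hA' hx)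
      simp only [ClassicalProtocol.transcript]
      rw [hτ x hxA y (hB' hy), if_pos hev, hxv]
    · obtain ⟨v, hv⟩ := exists_majority B fun y => P.bob i y τ
      refine reachable_of_restored R hC hρ (#J) (B.filter fun y => P.bob i y τ = v) A ?_
        (2 * Φ) J z _ A k le_rfl subset_rfl subset_rfl
        (hst.symm.half R (filter_subset _ _) hv) hk'
      intro Φ' J' z' B' A' k' hB' hA' hst' hk''
      refine ih (i + 1) (by omega) (Fin.snoc (α := fun _ => Bit) τ v) Φ' J' z' A' B' k'
        hst'.symm ?_ hk''
      intro x hx y hy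
      obtain ⟨hyB, hyv⟩ := mem_filter.mp (hB' hy)
      simp only [ClassicalProtocol.transcript]
      rw [hτ x (hA' hx) y hyB, if_neg hev, hyv]

end Structured

/-! ### Contractions -/

section Contractions

open Matrix

variable {l m n : Type*} [Fintype l] [Fintype m] [Fintype n]

/-- Both `M` and its adjoint have operator norm at most one. -/
structure IsContraction (M : Matrix m n ℂ) : Prop where
  mulVec_le : ∀ v, ∑ i, ‖(M *ᵥ v) i‖ ^ 2 ≤ ∑ j, ‖v j‖ ^ 2
  conjTranspose_mulVec_le : ∀ v, ∑ j, ‖(Mᴴ *ᵥ v) j‖ ^ 2 ≤ ∑ i, ‖v i‖ ^ 2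

lemma IsContraction.conjTranspose {M : Matrix m n ℂ} (h : IsContraction M) : IsContraction Mᴴ where
  mulVec_le := h.conjTranspose_mulVec_le
  conjTranspose_mulVec_le := by rw [conjTranspose_conjTranspose]; exact h.mulVec_le

lemma IsContraction.mul {M : Matrix l m ℂ} {M' : Matrix m n ℂ} (h : IsContraction M)
    (h' : IsContraction M') : IsContraction (M * M') where
  mulVec_le v := by
    rw [← mulVec_mulVec]
    exact (h.mulVec_le _).trans (h'.mulVec_le _)
  conjTranspose_mulVec_le v := by
    rw [conjTranspose_mul, ← mulVec_mulVec]
    exact (h'.conjTranspose_mulVec_le _).trans (h.conjTranspose_mulVec_le _)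

lemma norm_map_star_mulVec {m : Type*} (M : Matrix m n ℂ) (v : n → ℂ) (i : m) :
    ‖(M.map star *ᵥ v) i‖ = ‖(M *ᵥ star v) i‖ := by
  rw [← norm_star ((M *ᵥ star v) i)]
  congr 1
  simp [mulVec, dotProduct]

lemma IsContraction.transpose {M : Matrix m n ℂ} (h : IsContraction M) : IsContraction Mᵀ where
  mulVec_le v := by
    have h1 : Mᵀ = Mᴴ.map star := by ext; simp
    have h2 := h.conjTranspose_mulVec_le (star v)
    rw [h1]
    simp_rw [norm_map_star_mulVec]
    simpa using h2
  conjTranspose_mulVec_le v := by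
    have h1 : Mᵀᴴ = M.map star := by ext; simp
    have h2 := h.mulVec_le (star v)
    rw [h1]
    simp_rw [norm_map_star_mulVec]
    simpa using h2

lemma isContraction_zero : IsContraction (0 : Matrix m n ℂ) where
  mulVec_le v := by
    simp only [zero_mulVec, Pi.zero_apply, norm_zero]
    simpa using sum_nonneg fun i _ => sq_nonneg ‖v i‖
  conjTranspose_mulVec_le v := by
    simp only [conjTranspose_zero, zero_mulVec, Pi.zero_apply, norm_zero]
    simpa using sum_nonneg fun i _ => sq_nonneg ‖v i‖

lemma sum_norm_sq_eq (v : n → ℂ) : ((∑ i, ‖v i‖ ^ 2 : ℝ) : ℂ) = star v ⬝ᵥ v := by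
  push_cast
  refine sum_congr rfl fun i _ => ?_
  rw [Pi.star_apply, RCLike.star_def, Complex.conj_mul']

lemma sum_norm_sq_mulVec_of_conjTranspose_mul_self [DecidableEq n] {U : Matrix n n ℂ}
    (hU : Uᴴ * U = 1) (v : n → ℂ) : ∑ i, ‖(U *ᵥ v) i‖ ^ 2 = ∑ i, ‖v i‖ ^ 2 := by
  have h : ((∑ i, ‖(U *ᵥ v) i‖ ^ 2 : ℝ) : ℂ) = ((∑ i, ‖v i‖ ^ 2 : ℝ) : ℂ) := by
    rw [sum_norm_sq_eq, sum_norm_sq_eq, star_mulVec, dotProduct_mulVec, vecMul_vecMul, hU,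
      vecMul_one]
  exact_mod_cast h

/-- Extend `v` by zero along `g`, apply the isometry, and discard the coordinates outside the range
of `f`. -/
lemma sum_norm_sq_submatrix_mulVec_le [DecidableEq n] {U : Matrix n n ℂ} (hU : Uᴴ * U = 1)
    {f : l → n} {g : m → n} (hf : Function.Injective f) (hg : Function.Injective g) (v : m → ℂ) :
    ∑ i, ‖(U.submatrix f g *ᵥ v) i‖ ^ 2 ≤ ∑ j, ‖v j‖ ^ 2 := by
  classical
  set v' : n → ℂ := fun k => ∑ j, if g j = k then v j else 0 with hv'
  have h1 : ∀ i, (U.submatrix f g *ᵥ v) i = (U *ᵥ v') (f i) := by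
    intro i
    simp only [mulVec, dotProduct, submatrix_apply, hv', mul_sum]
    rw [sum_comm]
    simp
  have h2 : ∑ k, ‖v' k‖ ^ 2 = ∑ j, ‖v j‖ ^ 2 := by
    have h3 : ∀ j, v' (g j) = v j := fun j => by
      simp only [hv']
      rw [sum_eq_single j] <;> simp +contextual [hg.eq_iff]
    have h4 : ∀ k ∉ univ.image g, v' k = 0 := fun k hk => by
      simp only [hv']
      refine sum_eq_zero fun j _ => if_neg fun hj => hk ?_
      exact mem_image.mpr ⟨j, mem_univ j, hj⟩
    rw [← sum_subset (subset_univ (univ.image g)) fun k _ hk => by rw [h4 k hk]; simp,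
      sum_image fun i _ j _ h => hg h]
    simp_rw [h3]
  simp_rw [h1]
  calc ∑ i, ‖(U *ᵥ v') (f i)‖ ^ 2 = ∑ k ∈ univ.image f, ‖(U *ᵥ v') k‖ ^ 2 := by
        rw [sum_image fun i _ j _ h => hf h]
    _ ≤ ∑ k, ‖(U *ᵥ v') k‖ ^ 2 :=
        sum_le_sum_of_subset_of_nonneg (subset_univ _) fun _ _ _ => by positivity
    _ = _ := by rw [sum_norm_sq_mulVec_of_conjTranspose_mul_self hU, h2]

/-- A block of a unitary matrix is a contraction. -/
lemma isContraction_submatrix [DecidableEq n] (U : Matrix.unitaryGroup n ℂ)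
    {f : l → n} {g : m → n} (hf : Function.Injective f) (hg : Function.Injective g) :
    IsContraction (U.1.submatrix f g) where
  mulVec_le := sum_norm_sq_submatrix_mulVec_le
    (by simpa [star_eq_conjTranspose] using UnitaryGroup.star_mul_self U) hf hg
  conjTranspose_mulVec_le := by
    rw [conjTranspose_submatrix]
    refine sum_norm_sq_submatrix_mulVec_le ?_ hg hf
    rw [conjTranspose_conjTranspose]
    exact (Matrix.mem_unitaryGroup_iff (A := U.1)).mp U.2

lemma IsContraction.sum_norm_sq_mul_le {C : Matrix l m ℂ} (h : IsContraction C)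
    (M : Matrix m n ℂ) : ∑ i, ∑ j, ‖(C * M) i j‖ ^ 2 ≤ ∑ i, ∑ j, ‖M i j‖ ^ 2 := by
  rw [sum_comm, sum_comm (f := fun i j => ‖M i j‖ ^ 2)]
  refine sum_le_sum fun j _ => ?_
  exact h.mulVec_le fun i => M i j

end Contractions

/-! ### Acceptance probabilities of quantum protocols -/

section Quantum

open Matrix

variable {X Y : Type} [Fintype X] [DecidableEq X] [Fintype Y] [DecidableEq Y]

namespace QuantumProtocol

/-- The embedding of the workspace with input register `x`. -/
def inputEmbedding (X : Type) [DecidableEq X] (k : ℕ) (x : X) : Matrix (X × Fin k) (Fin k) ℂ :=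
  fun a w => if a.1 = x ∧ a.2 = w then 1 else 0

lemma isContraction_inputEmbedding (k : ℕ) (x : X) :
    IsContraction (inputEmbedding X k x) := by
  have h : inputEmbedding X k x =
      (1 : Matrix.unitaryGroup (X × Fin k) ℂ).1.submatrix id fun w => (x, w) := by
    ext a w
    simp [inputEmbedding, Matrix.one_apply, Prod.ext_iff]
  rw [h]
  exact isContraction_submatrix _ Function.injective_id fun w w' h => (Prod.ext_iff.mp h).2

/-- The state after `t` rounds is a sum of at most `2 ^ t` terms in which contractions depending on
one input each are applied to the two sides of the entangled state. -/
lemma exists_stateAfter_eq (P : QuantumProtocol X Y) (t : ℕ) :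
    ∃ (ρ : Type) (_ : Fintype ρ) (F : ρ → X → Bit → Matrix (X × Fin P.kA) (Fin P.kA) ℂ)
      (H : ρ → Y → Bit → Matrix (Fin P.kB) (Y × Fin P.kB) ℂ),
      Fintype.card ρ = 2 ^ t ∧ (∀ r x s, IsContraction (F r x s)) ∧
      (∀ r y s, IsContraction (H r y s)) ∧
      ∀ x y a s b, P.stateAfter x y t a s b =
        ∑ r, (F r x s * (of P.entanglement) * H r y s) a b := by
  induction t with
  | zero =>
    refine ⟨Unit, inferInstance, fun _ x s => if s = 0 then inputEmbedding X P.kA x else 0,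
      fun _ y _ => (inputEmbedding Y P.kB y)ᵀ, by simp, fun _ x s => ?_,
      fun _ y _ => (isContraction_inputEmbedding _ y).transpose, fun x y a s b => ?_⟩
    · beta_reduce
      split_ifs
      · exact isContraction_inputEmbedding _ x
      · exact isContraction_zero
    · obtain ⟨a₁, a₂⟩ := a
      obtain ⟨b₁, b₂⟩ := b
      simp only [stateAfter, initialState, univ_unique, sum_singleton]
      by_cases hs : s = 0
      · simp only [hs, if_true, true_and, Matrix.mul_apply, inputEmbedding, of_apply,
          transpose_apply]
        by_cases h1 : a₁ = x <;> by_cases h2 : b₁ = y <;> simp [h1, h2]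
      · simp [hs]
  | succ t ih =>
    obtain ⟨ρ, _, F, H, hcard, hF, hH, hst⟩ := ih
    by_cases hev : Even t ↔ P.aliceFirst = true
    -- The new summation index is the channel bit before the round, so the number of terms doubles;
    -- the silent party's factor is merely evaluated at that bit.
    · refine ⟨Bit × ρ, inferInstance,
        fun p x s => (P.aliceU t).1.submatrix (fun a => (a, s)) (fun a => (a, p.1)) * F p.2 x p.1,
        fun p y s => H p.2 y p.1, ?_, fun p x s => ?_, fun p y s => hH _ _ _, fun x y a s b => ?_⟩
      · rw [Fintype.card_prod, hcard, pow_succ, mul_comm, ZMod.card]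
      · exact (isContraction_submatrix _ (fun _ _ h => (Prod.ext_iff.mp h).1)
          (fun _ _ h => (Prod.ext_iff.mp h).1)).mul (hF _ _ _)
      · rw [stateAfter, if_pos hev, applyAlice, sum_comm]
        refine Eq.trans ?_ (Fintype.sum_prod_type _).symm
        refine sum_congr rfl fun s' _ => ?_
        calc _ = ∑ a', ∑ r, (P.aliceU t).1 (a, s) (a', s') *
                (F r x s' * of P.entanglement * H r y s') a' b :=
              sum_congr rfl fun a' _ => by rw [hst, mul_sum]
          _ = _ := by
              rw [sum_comm]
              refine sum_congr rfl fun r _ => ?_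
              have h1 : ∀ M : Matrix (X × Fin P.kA) (X × Fin P.kA) ℂ,
                  M * F r x s' * of P.entanglement * H r y s' =
                    M * (F r x s' * of P.entanglement * H r y s') := fun M => by
                simp only [Matrix.mul_assoc]
              rw [h1, Matrix.mul_apply]
              rfl
    · refine ⟨Bit × ρ, inferInstance, fun p x s => F p.2 x p.1,
        fun p y s => H p.2 y p.1 *
          ((P.bobU t).1.submatrix (fun b => (s, b)) (fun b => (p.1, b)))ᵀ,
        ?_, fun p x s => hF _ _ _, fun p y s => ?_, fun x y a s b => ?_⟩
      · rw [Fintype.card_prod, hcard, pow_succ, mul_comm, ZMod.card]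
      · exact (hH _ _ _).mul (isContraction_submatrix _ (fun _ _ h => (Prod.ext_iff.mp h).2)
          (fun _ _ h => (Prod.ext_iff.mp h).2)).transpose
      · rw [stateAfter, if_neg hev, applyBob]
        refine Eq.trans ?_ (Fintype.sum_prod_type _).symm
        refine sum_congr rfl fun s' _ => ?_
        calc _ = ∑ b', ∑ r, (P.bobU t).1 (s, b) (s', b') *
                (F r x s' * of P.entanglement * H r y s') a b' :=
              sum_congr rfl fun b' _ => by rw [hst, mul_sum]
          _ = _ := by
              rw [sum_comm]
              refine sum_congr rfl fun r _ => ?_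
              rw [← Matrix.mul_assoc, Matrix.mul_apply]
              exact sum_congr rfl fun b' _ => by simp [mul_comm]

/-- The acceptance probability of a `t`-round protocol is an inner product of vectors of squared
length at most `4 ^ t`, each of which depends on one input only. -/
theorem exists_probNegOne_eq (P : QuantumProtocol X Y) (t : ℕ) :
    ∃ (E : Type) (_ : Fintype E) (u : X → E → ℝ) (v : Y → E → ℝ),
      (∀ x, ∑ e, u x e ^ 2 ≤ 4 ^ t) ∧ (∀ y, ∑ e, v y e ^ 2 ≤ 4 ^ t) ∧
      ∀ x y, P.probNegOne t x y = ∑ e, u x e * v y e := by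
  obtain ⟨ρ, _, F, H, hcard, hF, hH, hst⟩ := P.exists_stateAfter_eq t
  set α : Matrix (Fin P.kA) (Fin P.kB) ℂ := of P.entanglement with hα
  have hαn : ∑ i, ∑ j, ‖α i j‖ ^ 2 = 1 := P.entanglement_norm
  have hαn' : ∑ i, ∑ j, ‖αᴴ i j‖ ^ 2 = 1 := by
    rw [sum_comm, ← hαn]
    simp
  -- The acceptance probability is the squared Frobenius norm of a sum of `F α H`. Expanding and
  -- cycling the trace leaves one of `α`, `αᴴ` with each party, so both factors have Frobenius norm
  -- at most 1 in any dimension.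
  set U : X → ρ × ρ → Matrix (Fin P.kA) (Fin P.kB) ℂ :=
    fun x p => (F p.1 x 1)ᴴ * F p.2 x 1 * α with hU
  set V : Y → ρ × ρ → Matrix (Fin P.kB) (Fin P.kA) ℂ :=
    fun y p => H p.2 y 1 * (H p.1 y 1)ᴴ * αᴴ with hV
  have hUn : ∀ x p, ∑ i, ∑ j, ‖U x p i j‖ ^ 2 ≤ 1 := fun x p =>
    (((hF p.1 x 1).conjTranspose.mul (hF p.2 x 1)).sum_norm_sq_mul_le α).trans_eq hαn
  have hVn : ∀ y p, ∑ i, ∑ j, ‖V y p i j‖ ^ 2 ≤ 1 := fun y p =>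
    (((hH p.2 y 1).mul (hH p.1 y 1).conjTranspose).sum_norm_sq_mul_le αᴴ).trans_eq hαn'
  have hc : (Fintype.card (ρ × ρ) : ℝ) = 4 ^ t := by
    rw [Fintype.card_prod, hcard]
    push_cast
    rw [← mul_pow]
    norm_num
  have hsq : ∀ z : ℂ, z.re ^ 2 + z.im ^ 2 = ‖z‖ ^ 2 := fun z => by
    rw [← Complex.normSq_eq_norm_sq, Complex.normSq_apply]; ring
  -- Real and imaginary parts become separate coordinates; the minus sign comes from `Re (zw) = Re z
  -- Re w - Im z Im w`.
  refine ⟨(ρ × ρ) × (Fin P.kA × Fin P.kB) × Bool, inferInstance,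
    fun x e => cond e.2.2 (U x e.1 e.2.1.1 e.2.1.2).re (U x e.1 e.2.1.1 e.2.1.2).im,
    fun y e => cond e.2.2 (V y e.1 e.2.1.2 e.2.1.1).re (-(V y e.1 e.2.1.2 e.2.1.1).im),
    fun x => ?_, fun y => ?_, fun x y => ?_⟩
  · rw [← hc, Fintype.sum_prod_type, ← nsmul_one, ← card_univ]
    refine sum_le_card_nsmul _ _ _ fun p _ => (le_of_eq ?_).trans (hUn x p)
    simp only [Fintype.sum_prod_type, Fintype.sum_bool, cond_true, cond_false, hsq]
  · rw [← hc, Fintype.sum_prod_type, ← nsmul_one, ← card_univ]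
    refine sum_le_card_nsmul _ _ _ fun p _ => (le_of_eq ?_).trans (hVn y p)
    simp only [Fintype.sum_prod_type, Fintype.sum_bool, cond_true, cond_false, neg_sq, hsq]
    rw [sum_comm]
  · have h1 : ((P.probNegOne t x y : ℝ) : ℂ) = ∑ p : ρ × ρ, (U x p * V y p).trace := by
      have h2 : ∀ p : ρ × ρ, (U x p * V y p).trace =
          ((F p.1 x 1 * α * H p.1 y 1)ᴴ * (F p.2 x 1 * α * H p.2 y 1)).trace := by
        intro p
        simp only [hU, hV, conjTranspose_mul]
        rw [Matrix.trace_mul_comm ((H p.1 y 1)ᴴ * _), Matrix.mul_assoc, Matrix.mul_assoc,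
          Matrix.trace_mul_comm]
        simp only [Matrix.mul_assoc]
      simp_rw [h2]
      simp only [probNegOne, hst]
      push_cast
      have h3 : ∀ z : ℂ, ((‖z‖ : ℂ)) ^ 2 = star z * z := fun z => by
        rw [RCLike.star_def, Complex.conj_mul']
      have h5 : ∀ g : (X × Fin P.kA) → (Y × Fin P.kB) → ρ × ρ → ℂ,
          ∑ a, ∑ b, ∑ p, g a b p = ∑ p, ∑ b, ∑ a, g a b p := fun g => by
        rw [sum_comm]
        exact (sum_congr rfl fun b _ => sum_comm).trans sum_comm
      have h6 : ∀ a b, star (∑ r, (F r x 1 * α * H r y 1) a b) *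
          ∑ r, (F r x 1 * α * H r y 1) a b =
          ∑ p : ρ × ρ, star ((F p.1 x 1 * α * H p.1 y 1) a b) *
            (F p.2 x 1 * α * H p.2 y 1) a b := fun a b => by
        rw [star_sum, sum_mul_sum, Fintype.sum_prod_type]
      simp_rw [h3, h6]
      rw [h5]
      rfl
    have h4 : P.probNegOne t x y = ∑ p : ρ × ρ, ((U x p * V y p).trace).re := by
      rw [← Complex.re_sum, ← h1, Complex.ofReal_re]
    rw [h4]
    refine Eq.trans ?_ (Fintype.sum_prod_type _).symm
    refine sum_congr rfl fun p _ => ?_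
    simp only [Matrix.trace, diag_apply, Matrix.mul_apply, Complex.re_sum, Complex.mul_re,
      Fintype.sum_prod_type, Fintype.sum_bool, cond_true, cond_false]
    exact sum_congr rfl fun i _ => sum_congr rfl fun j _ => by ring

/-- The squared length of a state. -/
def normSq (P : QuantumProtocol X Y) (ψ : P.State) : ℝ :=
  ∑ a, ∑ s, ∑ b, ‖ψ a s b‖ ^ 2

lemma normSq_applyAlice (P : QuantumProtocol X Y)
    (U : Matrix.unitaryGroup ((X × Fin P.kA) × Bit) ℂ) (ψ : P.State) :
    P.normSq (P.applyAlice U ψ) = P.normSq ψ := by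
  have h : ∀ ψ : P.State, P.normSq ψ =
      ∑ b, ∑ p : (X × Fin P.kA) × Bit, ‖ψ p.1 p.2 b‖ ^ 2 := fun ψ => by
    rw [sum_comm]
    exact (Fintype.sum_prod_type fun p : (X × Fin P.kA) × Bit => ∑ b, ‖ψ p.1 p.2 b‖ ^ 2).symm
  rw [h, h]
  refine sum_congr rfl fun b _ => ?_
  have hU : (U.1)ᴴ * U.1 = 1 := by
    simpa [star_eq_conjTranspose] using UnitaryGroup.star_mul_self U
  rw [← sum_norm_sq_mulVec_of_conjTranspose_mul_self hU fun p => ψ p.1 p.2 b]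
  refine sum_congr rfl fun p _ => ?_
  congr 2
  exact (Fintype.sum_prod_type fun q : (X × Fin P.kA) × Bit => U.1 p q * ψ q.1 q.2 b).symm

lemma normSq_applyBob (P : QuantumProtocol X Y)
    (U : Matrix.unitaryGroup (Bit × (Y × Fin P.kB)) ℂ) (ψ : P.State) :
    P.normSq (P.applyBob U ψ) = P.normSq ψ := by
  have h : ∀ ψ : P.State, P.normSq ψ =
      ∑ a, ∑ p : Bit × (Y × Fin P.kB), ‖ψ a p.1 p.2‖ ^ 2 := fun ψ =>
    sum_congr rfl fun a _ =>
      (Fintype.sum_prod_type fun p : Bit × (Y × Fin P.kB) => ‖ψ a p.1 p.2‖ ^ 2).symm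
  rw [h, h]
  refine sum_congr rfl fun a _ => ?_
  have hU : (U.1)ᴴ * U.1 = 1 := by
    simpa [star_eq_conjTranspose] using UnitaryGroup.star_mul_self U
  rw [← sum_norm_sq_mulVec_of_conjTranspose_mul_self hU fun p => ψ a p.1 p.2]
  refine sum_congr rfl fun p _ => ?_
  congr 2
  exact (Fintype.sum_prod_type fun q : Bit × (Y × Fin P.kB) => U.1 p q * ψ a q.1 q.2).symm

lemma normSq_initialState (P : QuantumProtocol X Y) (x : X) (y : Y) :
    P.normSq (P.initialState x y) = 1 := by
  have h : ∀ a s b, ‖P.initialState x y a s b‖ ^ 2 =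
      if a.1 = x then if s = 0 then if b.1 = y then ‖P.entanglement a.2 b.2‖ ^ 2 else 0 else 0
        else 0 := by
    intro a s b
    unfold initialState
    by_cases h1 : a.1 = x <;> by_cases h2 : s = 0 <;> by_cases h3 : b.1 = y <;> simp [h1, h2, h3]
  rw [← P.entanglement_norm, normSq, Fintype.sum_prod_type]
  simp_rw [h, sum_comm (s := (univ : Finset Bit)), Fintype.sum_prod_type]
  simp [sum_ite_irrel]

lemma normSq_stateAfter (P : QuantumProtocol X Y) (x : X) (y : Y) (t : ℕ) :
    P.normSq (P.stateAfter x y t) = 1 := by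
  induction t with
  | zero => exact P.normSq_initialState x y
  | succ t ih =>
    rw [stateAfter]
    split_ifs
    · rw [normSq_applyAlice, ih]
    · rw [normSq_applyBob, ih]

lemma probNegOne_nonneg (P : QuantumProtocol X Y) (t : ℕ) (x : X) (y : Y) :
    0 ≤ P.probNegOne t x y :=
  sum_nonneg fun _ _ => sum_nonneg fun _ _ => sq_nonneg _

lemma probNegOne_le_one (P : QuantumProtocol X Y) (t : ℕ) (x : X) (y : Y) :
    P.probNegOne t x y ≤ 1 := by
  rw [← P.normSq_stateAfter x y t]
  exact sum_le_sum fun a _ => single_le_sum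
    (f := fun s => ∑ b, ‖P.stateAfter x y t a s b‖ ^ 2)
    (fun _ _ => sum_nonneg fun _ _ => sq_nonneg _) (mem_univ 1)

end QuantumProtocol

/-- A correct protocol approximates the function by the bias of its output. -/
lemma HybridProtocol.Computes.abs_sub_le {c q : ℕ} {P : HybridProtocol X Y c q}
    {F : X → Y → ℤˣ} {ε : ℝ} (h : P.Computes F ε) (x : X) (y : Y) {τ : Fin c → Bit}
    (hτ : P.classical.transcript x y c = τ) :
    |((F x y : ℤ) : ℝ) - (1 - 2 * P.quantum.probNegOne q (x, τ) (y, τ))| ≤ 2 * ε := by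
  have h1 := h x y
  rw [hτ, QuantumProtocol.probOutput] at h1
  have h2 := P.quantum.probNegOne_nonneg q (x, τ) (y, τ)
  have h3 := P.quantum.probNegOne_le_one q (x, τ) (y, τ)
  rcases Int.units_eq_one_or (F x y) with hF | hF
  · rw [hF, if_neg (by decide)] at h1
    rw [hF, abs_le]
    push_cast
    constructor <;> linarith
  · rw [hF, if_pos rfl] at h1
    rw [hF, abs_le]
    push_cast
    constructor <;> linarith

end Quantum

/-! ### Approximation on a structured rectangle -/

section Approximation

lemma degree_le_of_fourierCoeff_eq_zero {ι : Type} [Fintype ι] [DecidableEq ι]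
    {p : (ι → Bit) → ℝ} {D : ℕ} (h : ∀ S, D < #S → fourierCoeff p S = 0) : degree p ≤ D := by
  classical
  refine Finset.sup_le fun S hS => ?_
  by_contra hlt
  push Not at hlt
  exact (mem_filter.mp hS).2 (h S hlt)

lemma degree_sum_character_le {ι : Type} [Fintype ι] [DecidableEq ι] (c : Finset ι → ℝ) (D : ℕ) :
    degree (fun ω : ι → Bit => ∑ S ∈ univ.filter (fun S : Finset ι => #S ≤ D),
      c S * character S ω) ≤ D := by
  refine degree_le_of_fourierCoeff_eq_zero fun S hS => ?_
  have h : ∑ ω : ι → Bit, (∑ T ∈ univ.filter (fun S : Finset ι => #S ≤ D),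
      c T * character T ω) * character S ω = 0 := by
    simp_rw [sum_mul]
    rw [sum_comm]
    refine sum_eq_zero fun T hT => ?_
    have hne : T ≠ S := by
      rintro rfl
      exact absurd (mem_filter.mp hT).2 (not_le.mpr hS)
    simp_rw [mul_assoc, ← mul_sum, sum_character_mul_character_point, if_neg hne, mul_zero]
  rw [fourierCoeff, h, zero_div]

lemma approxDegree_le {ι : Type} [Fintype ι] [DecidableEq ι] {ε : ℝ} {f : (ι → Bit) → ℤˣ}
    (p : (ι → Bit) → ℝ) (h : ∀ x, |((f x : ℤ) : ℝ) - p x| ≤ ε) : approxDegree ε f ≤ degree p :=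
  Nat.sInf_le ⟨p, rfl, h⟩

variable {n b : ℕ}

lemma gadgetSign_map_subtype {J : Finset (Fin n)} (S : Finset {i // i ∈ J})
    (x y : Fin n → Fin b → Bit) :
    gadgetSign (S.map (Function.Embedding.subtype _)) x y =
      character S fun i => innerProductGadget (x i) (y i) := by
  simp [gadgetSign, character_eq_prod_sign]

/-- The correlation of a sign matrix with a matrix of inner products on a dense rectangle. -/
lemma abs_sum_gadgetSign_mul_inner_le {E : Type*} [Fintype E] {r a C : ℝ} (ha : 0 ≤ a)
    (hra : r ^ 2 * 2 ^ b ≤ a ^ 2) (hC : 0 ≤ C) {J : Finset (Fin n)}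
    {A B : Finset (Fin n → Fin b → Bit)} (hA : Dense r J A) (hB : Dense r J B)
    (u v : (Fin n → Fin b → Bit) → E → ℝ) (hu : ∀ x ∈ A, ∑ e, u x e ^ 2 ≤ C)
    (hv : ∀ y ∈ B, ∑ e, v y e ^ 2 ≤ C) {S : Finset (Fin n)} (hS : S ⊆ J) :
    |∑ x ∈ A, ∑ y ∈ B, gadgetSign S x y * ∑ e, u x e * v y e| ≤ C * a ^ #S * (#A * #B) := by
  refine abs_le_of_sq_le_sq ?_ (by positivity)
  refine (sum_gadgetSign_mul_inner_sq_le A B S _ _ (hA S hS) (hB S hS) u v C hu hv).trans ?_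
  calc r ^ #S * #A * (r ^ #S * #B) * (2 ^ b) ^ #S * (#A * C) * (#B * C)
      = (r ^ 2 * 2 ^ b) ^ #S * (C * (#A * #B)) ^ 2 := by rw [mul_pow, ← pow_mul]; ring
    _ ≤ (a ^ 2) ^ #S * (C * (#A * #B)) ^ 2 := by gcongr
    _ = _ := by rw [← pow_mul]; ring

/-- If inner products of short vectors approximate `f ∘ G^n` on a dense rectangle on which the
gadget has the values `z` off `J`, then `f_{J,z}` has small approximate degree. -/
theorem approxDegree_restriction_le {E : Type*} [Fintype E] (f : (Fin n → Bit) → ℤˣ)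
    {r a d g C Φ : ℝ} (ha : 0 ≤ a) (hra : r ^ 2 * 2 ^ b ≤ a ^ 2) (hC : 0 ≤ C) (hd : 0 ≤ d)
    (hd1 : d ≤ 1) (hg : 0 ≤ g) (hadg : a ≤ d * g) {J : Finset (Fin n)} {z : Fin n → Bit}
    {A B : Finset (Fin n → Fin b → Bit)} (hst : Structured r r Φ J z A B)
    (u v : (Fin n → Fin b → Bit) → E → ℝ) (hu : ∀ x ∈ A, ∑ e, u x e ^ 2 ≤ C)
    (hv : ∀ y ∈ B, ∑ e, v y e ^ 2 ≤ C)
    (hf : ∀ x ∈ A, ∀ y ∈ B, |((composed b f x y : ℤ) : ℝ) - (1 - 2 * ∑ e, u x e * v y e)| ≤ 1 / 5)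
    (hbal : (1 + a) ^ n - 1 ≤ 1 / 20) (D : ℕ)
    (htail : (1 + 2 * C) * d ^ (D + 1) * (1 + g) ^ n ≤ 1 / 20) :
    approxDegree (1 / 3) (restriction f J fun i => z i) ≤ D := by
  classical
  have hcA : (0 : ℝ) < #A := by exact_mod_cast hst.nonempty_left.card_pos
  have hcB : (0 : ℝ) < #B := by exact_mod_cast hst.nonempty_right.card_pos
  set W : (Fin n → Fin b → Bit) → (Fin n → Fin b → Bit) → ({i // i ∈ J} → Bit) :=
    fun x y i => innerProductGadget (x i) (y i) with hW
  set Z : ℝ := #A * #B with hZ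
  have hZ0 : 0 < Z := by positivity
  -- `Γ h` is the Fourier transform of the push-forward of `h` from `A × B` along the gadget: its
  -- inversion at `ω` is `2 ^ |J|` times the average of `h` restricted to `W = ω`.
  set Γ : ((Fin n → Fin b → Bit) → (Fin n → Fin b → Bit) → ℝ) → Finset {i // i ∈ J} → ℝ :=
    fun h S => (∑ x ∈ A, ∑ y ∈ B, character S (W x y) * h x y) / Z with hΓ
  set π : (Fin n → Fin b → Bit) → (Fin n → Fin b → Bit) → ℝ :=
    fun x y => 1 - 2 * ∑ e, u x e * v y e with hπ
  have hsub : ∀ S : Finset {i // i ∈ J}, S.map (Function.Embedding.subtype _) ⊆ J := by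
    intro S i hi
    obtain ⟨j, -, rfl⟩ := mem_map.mp hi
    exact j.2
  have hone : ∀ S, |Γ (fun _ _ => 1) S| ≤ a ^ #S := by
    intro S
    have h := abs_sum_gadgetSign_mul_inner_le (E := Unit) ha hra zero_le_one hst.dense_left
      hst.dense_right (fun _ _ => 1) (fun _ _ => 1) (by simp) (by simp) (hsub S)
    simp only [gadgetSign_map_subtype, card_map, univ_unique, sum_const, card_singleton, one_smul,
      mul_one, one_mul] at h
    rw [hΓ, abs_div, abs_of_pos hZ0, div_le_iff₀ hZ0]
    simpa [hW] using h
  have hπΓ : ∀ S, |Γ π S| ≤ (1 + 2 * C) * a ^ #S := by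
    intro S
    have h := abs_sum_gadgetSign_mul_inner_le ha hra hC hst.dense_left
      hst.dense_right u v hu hv (hsub S)
    simp only [gadgetSign_map_subtype, card_map] at h
    have h2 : Γ π S = Γ (fun _ _ => 1) S -
        2 * ((∑ x ∈ A, ∑ y ∈ B, character S (W x y) * ∑ e, u x e * v y e) / Z) := by
      simp only [hΓ, hπ]
      rw [mul_div_assoc', ← sub_div, mul_sum, ← sum_sub_distrib]
      congr 1
      refine sum_congr rfl fun x _ => ?_
      rw [mul_sum, ← sum_sub_distrib]
      exact sum_congr rfl fun y _ => by ring
    have h3 : |(∑ x ∈ A, ∑ y ∈ B, character S (W x y) * ∑ e, u x e * v y e) / Z| ≤ C * a ^ #S := by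
      rw [abs_div, abs_of_pos hZ0, div_le_iff₀ hZ0]
      exact h
    rw [h2]
    refine (abs_sub _ _).trans ?_
    rw [abs_mul, abs_two]
    linarith [hone S]
  have hinv : ∀ h ω, ∑ S, Γ h S * character S ω =
      (∑ x ∈ A, ∑ y ∈ B, (if W x y = ω then (2 : ℝ) ^ Fintype.card {i // i ∈ J} else 0) *
        h x y) / Z := by
    intro h ω
    simp only [hΓ, div_mul_eq_mul_div, ← sum_div]
    congr 1
    simp_rw [sum_mul]
    rw [sum_comm]
    refine sum_congr rfl fun x _ => ?_
    rw [sum_comm]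
    refine sum_congr rfl fun y _ => ?_
    rw [← sum_character_mul_character, sum_mul]
    exact sum_congr rfl fun S _ => by ring
  have hcardJ : Fintype.card {i // i ∈ J} ≤ n := by
    simpa using card_le_univ J
  refine (approxDegree_le _ fun ω => ?_).trans (degree_sum_character_le (Γ π) D)
  set φ : ℝ := ((restriction f J (fun i => z i) ω : ℤ) : ℝ) with hφ
  have hφ1 : |φ| = 1 := by
    rcases Int.units_eq_one_or (restriction f J (fun i => z i) ω) with h | h <;> simp [hφ, h]
  -- `Q` is the density at `ω` of the gadget values relative to uniform.
  set Q : ℝ := ∑ S, Γ (fun _ _ => 1) S * character S ω with hQ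
  have hQ1 : |Q - 1| ≤ 1 / 20 := by
    have h1 : Γ (fun _ _ => 1) ∅ * character ∅ ω = 1 := by
      simp only [hΓ, character_eq_prod_sign, prod_empty, mul_one, sum_const, nsmul_eq_mul]
      rw [← hZ, div_self hZ0.ne']
    have h2 : Q - 1 = ∑ S ∈ univ.erase ∅, Γ (fun _ _ => 1) S * character S ω := by
      rw [hQ, ← add_sum_erase univ _ (mem_univ ∅), h1]
      ring
    rw [h2]
    calc |∑ S ∈ univ.erase ∅, Γ (fun _ _ => 1) S * character S ω|
        ≤ ∑ S ∈ univ.erase ∅, |Γ (fun _ _ => 1) S * character S ω| := abs_sum_le_sum_abs _ _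
      _ ≤ ∑ S ∈ univ.erase (∅ : Finset {i // i ∈ J}), a ^ #S := by
          refine sum_le_sum fun S _ => ?_
          rw [abs_mul, abs_character, mul_one]
          exact hone S
      _ = (1 + a) ^ Fintype.card {i // i ∈ J} - 1 := by
          rw [← sum_pow_card_fintype, ← add_sum_erase univ _ (mem_univ ∅)]
          simp
      _ ≤ (1 + a) ^ n - 1 := by
          gcongr
          linarith
      _ ≤ 1 / 20 := hbal
  have hmain : |∑ S, Γ π S * character S ω - φ * Q| ≤ 1 / 5 * Q := by
    rw [hQ, hinv, hinv, mul_div_assoc', mul_div_assoc', ← sub_div, abs_div, abs_of_pos hZ0,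
      mul_sum, mul_sum, ← sum_sub_distrib]
    gcongr
    refine (abs_sum_le_sum_abs _ _).trans (sum_le_sum fun x hx => ?_)
    rw [mul_sum, mul_sum, ← sum_sub_distrib]
    refine (abs_sum_le_sum_abs _ _).trans (sum_le_sum fun y hy => ?_)
    split_ifs with hω
    · have hcomp : ((composed b f x y : ℤ) : ℝ) = φ := by
        rw [hφ, composed, restriction]
        congr 3
        funext i
        split_ifs with hi
        · rw [← hω]
        · exact hst.gadget_eq x hx y hy i hi
      have h1 := hf x hx y hy
      rw [hcomp, abs_sub_comm] at h1
      have h2 : ∀ M : ℝ, M * π x y - φ * (M * 1) = M * (π x y - φ) := fun M => by ring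
      rw [h2, abs_mul, abs_of_nonneg (by positivity), mul_one, mul_comm (1 / 5 : ℝ)]
      exact mul_le_mul_of_nonneg_left h1 (by positivity)
    · simp
  have htail' : |∑ S, Γ π S * character S ω -
      ∑ S ∈ univ.filter (fun S : Finset {i // i ∈ J} => #S ≤ D), Γ π S * character S ω| ≤
      1 / 20 := by
    rw [← sum_filter_add_sum_filter_not univ (fun S : Finset {i // i ∈ J} => #S ≤ D),
      add_sub_cancel_left]
    calc |∑ S ∈ univ.filter (fun S : Finset {i // i ∈ J} => ¬ #S ≤ D), Γ π S * character S ω|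
        ≤ ∑ S ∈ univ.filter (fun S : Finset {i // i ∈ J} => ¬ #S ≤ D),
            |Γ π S * character S ω| := abs_sum_le_sum_abs _ _
      -- In the split `a ≤ d * g`, the powers of `d` beat the factor `1 + 2 * C`, and those of `g`
      -- keep the sum over all `S` bounded.
      _ ≤ ∑ S ∈ univ.filter (fun S : Finset {i // i ∈ J} => ¬ #S ≤ D),
            (1 + 2 * C) * d ^ (D + 1) * g ^ #S := by
          refine sum_le_sum fun S hS => ?_
          have hDS : D + 1 ≤ #S := not_le.mp (mem_filter.mp hS).2
          rw [abs_mul, abs_character, mul_one]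
          calc |Γ π S| ≤ (1 + 2 * C) * a ^ #S := hπΓ S
            _ ≤ (1 + 2 * C) * (d * g) ^ #S := by gcongr
            _ = (1 + 2 * C) * d ^ #S * g ^ #S := by rw [mul_pow]; ring
            _ ≤ _ := by
                exact mul_le_mul_of_nonneg_right (mul_le_mul_of_nonneg_left
                  (pow_le_pow_of_le_one hd hd1 hDS) (by positivity)) (by positivity)
      _ ≤ ∑ S : Finset {i // i ∈ J}, (1 + 2 * C) * d ^ (D + 1) * g ^ #S :=
          sum_le_sum_of_subset_of_nonneg (filter_subset _ _) fun _ _ _ => by positivity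
      _ = (1 + 2 * C) * d ^ (D + 1) * (1 + g) ^ Fintype.card {i // i ∈ J} := by
          rw [← mul_sum, sum_pow_card_fintype]
      _ ≤ (1 + 2 * C) * d ^ (D + 1) * (1 + g) ^ n := by
          gcongr
          linarith
      _ ≤ 1 / 20 := htail
  have hfirst : |φ - φ * Q| ≤ 1 / 20 := by
    rw [show φ - φ * Q = φ * (1 - Q) by ring, abs_mul, hφ1, one_mul, abs_sub_comm]
    exact hQ1
  -- The errors add up to at most `1/5 * 21/20 + 1/20 + 1/20 = 31/100`.
  rw [abs_le] at *
  constructor <;> linarith [hmain.1, hmain.2, htail'.1, htail'.2, hfirst.1, hfirst.2, hQ1.1, hQ1.2]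

end Approximation

/-! ### The choice of rates -/

section Constants

lemma one_add_pow_sub_one_le {n : ℕ} {x : ℝ} (hx : 0 ≤ x) (h : n * x ≤ 1) :
    (1 + x) ^ n - 1 ≤ 2 * (n * x) := by
  have h1 : (1 + x) ^ n ≤ Real.exp (n * x) := by
    rw [Real.exp_nat_mul]
    gcongr
    linarith [Real.add_one_le_exp x]
  have h0 : 0 ≤ n * x := by positivity
  have h2 := Real.abs_exp_sub_one_le (x := n * x) (by rwa [abs_of_nonneg h0])
  rw [abs_of_nonneg h0] at h2
  linarith [le_abs_self (Real.exp (n * x) - 1)]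

/-- The rates used for `n` coordinates with a gadget on about `20 log n` bits. -/
def standardRates {n b : ℕ} (hn : 1000 ≤ n) (hb : (2 : ℝ) ^ b ≤ 2 * (n : ℝ) ^ 20) : Rates n b :=
  have hn' : (1000 : ℝ) ≤ n := by exact_mod_cast hn
  have hn0 : (0 : ℝ) < n := by linarith
  have hy : (n : ℝ)⁻¹ ≤ 1 / 1000 := by
    rw [inv_le_comm₀ hn0 (by norm_num)]
    simpa using hn'
  have hy0 : 0 < (n : ℝ)⁻¹ := by positivity
  have hny : (n : ℝ) * (n : ℝ)⁻¹ = 1 := mul_inv_cancel₀ hn0.ne'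
  have hsq : (n : ℝ) * (n : ℝ)⁻¹ ^ 2 = (n : ℝ)⁻¹ := by rw [sq, ← mul_assoc, hny, one_mul]
  -- With `2 ^ b` about `n ^ 20`, `r₁` is one power of `n` above the uniform rate, so a query gains
  -- about `n`. Since `ν * t ^ 2 = n ^ (-31)` is short of `r₁` by `n ^ 12`, the weight is `w = n ^
  -- 6`.
  { r₁ := (n : ℝ)⁻¹ ^ 19
    r₂ := (n : ℝ)⁻¹ ^ 14
    t := (n : ℝ)⁻¹ ^ 15
    κ := (n : ℝ)⁻¹ ^ 2
    μ := (n : ℝ)⁻¹ ^ 2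
    ν := (n : ℝ)⁻¹
    w := (n : ℝ) ^ 6
    r₁_pos := by positivity
    t_pos := by positivity
    κ_pos := by positivity
    κ_le := pow_le_one₀ hy0.le (by linarith)
    μ_nonneg := by positivity
    ν_nonneg := by positivity
    w_le := one_le_pow₀ (by linarith)
    two_r₁ := by
      have h : (n : ℝ)⁻¹ ^ 5 ≤ (n : ℝ)⁻¹ := pow_le_of_le_one hy0.le (by linarith) (by norm_num)
      calc 2 * (n : ℝ)⁻¹ ^ 19 = (n : ℝ)⁻¹ ^ 14 * (2 * (n : ℝ)⁻¹ ^ 5) := by ring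
        _ ≤ (n : ℝ)⁻¹ ^ 14 * 1 := by gcongr; linarith
        _ = _ := mul_one _
    three_t := by
      calc 3 * (n : ℝ)⁻¹ ^ 15 = (n : ℝ)⁻¹ ^ 14 * (3 * (n : ℝ)⁻¹) := by ring
        _ ≤ (n : ℝ)⁻¹ ^ 14 * 1 := by gcongr; linarith
        _ = _ := mul_one _
    r₁_le_t := pow_le_pow_of_le_one hy0.le (by linarith) (by norm_num)
    r₁_le := by rw [← pow_mul, ← pow_add]
    moment_le := by
      calc (n : ℝ)⁻¹ ^ 14 * (n : ℝ)⁻¹ ^ 19 * 2 ^ b * (n : ℝ) ^ 6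
          ≤ (n : ℝ)⁻¹ ^ 14 * (n : ℝ)⁻¹ ^ 19 * (2 * (n : ℝ) ^ 20) * (n : ℝ) ^ 6 := by gcongr
        _ = 2 * (n : ℝ)⁻¹ ^ 7 * ((n : ℝ) * (n : ℝ)⁻¹) ^ 26 := by ring
        _ = (n : ℝ)⁻¹ ^ 6 * (2 * (n : ℝ)⁻¹) := by rw [hny]; ring
        _ ≤ (n : ℝ)⁻¹ ^ 6 * 1 := by gcongr; linarith
        _ = _ := by ring
    r₁_le_w := by
      apply le_of_eq
      calc (n : ℝ)⁻¹ ^ 19 = (n : ℝ)⁻¹ ^ 19 * 1 ^ 12 := by ring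
        _ = _ := by rw [← hny]; ring
    union_le := by
      have h1 := one_add_pow_sub_one_le (n := n) (x := (n : ℝ)⁻¹ ^ 2) (by positivity)
        (by rw [hsq]; linarith)
      have h2 := one_add_pow_sub_one_le (n := n) (x := (n : ℝ)⁻¹) hy0.le (by rw [hny])
      rw [hsq] at h1
      rw [hny] at h2
      calc _ ≤ 2 * (n : ℝ)⁻¹ * 3 := by gcongr; linarith
        _ ≤ 1 / 2 := by linarith
    correlation_le := by
      have h1 := one_add_pow_sub_one_le (n := n) (x := (n : ℝ)⁻¹ ^ 2) (by positivity)
        (by rw [hsq]; linarith)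
      rw [hsq] at h1
      linarith }

lemma two_pow_bounds {n b : ℕ} (hn : 0 < n) (hb : |(b : ℝ) - 20 * Real.logb 2 n| < 1) :
    (2 : ℝ) ^ b ≤ 2 * (n : ℝ) ^ 20 ∧ (n : ℝ) ^ 20 ≤ 2 * 2 ^ b := by
  have hn0 : (0 : ℝ) < n := by exact_mod_cast hn
  have hlog : Real.logb 2 ((n : ℝ) ^ 20) = 20 * Real.logb 2 n := by
    rw [Real.logb_pow]; norm_num
  have hb' := abs_lt.mp hb
  constructor
  · have h : (b : ℝ) < Real.logb 2 (2 * (n : ℝ) ^ 20) := by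
      rw [Real.logb_mul (by norm_num) (by positivity), hlog, Real.logb_self_eq_one (by norm_num)]
      linarith
    rw [Real.lt_logb_iff_rpow_lt (by norm_num) (by positivity), Real.rpow_natCast] at h
    exact h.le
  · have h : Real.logb 2 ((n : ℝ) ^ 20) < ((b + 1 : ℕ) : ℝ) := by
      rw [hlog]
      push_cast
      linarith
    rw [Real.logb_lt_iff_lt_rpow (by norm_num) (by positivity), Real.rpow_natCast,
      pow_succ (2 : ℝ)] at h
    linarith

end Constants

end HybridLifting

end

/-! ### The main theorem: query count and degree bound. -/

theorem mainTheorem2 :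
    ∃ (K : ℝ) (n₀ : ℕ), 0 < K ∧ ∀ n : ℕ, n₀ ≤ n →
      ∀ b : ℕ, |(b : ℝ) - 20 * Real.logb 2 n| < 1 →
      ∀ (c q : ℕ)
        (P : HybridLifting.HybridProtocol (Fin n → Fin b → HybridLifting.Bit)
          (Fin n → Fin b → HybridLifting.Bit) c q)
        (f : (Fin n → HybridLifting.Bit) → ℤˣ),
        P.Computes (HybridLifting.composed b f) (1 / 10) →
        ∃ T : HybridLifting.DecisionTree n,
          (T.depth : ℝ) ≤ 200 * (c : ℝ) / (b : ℝ) ∧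
          ∀ x : Fin n → HybridLifting.Bit,
            (HybridLifting.approxDegree (1 / 3)
              (HybridLifting.restriction f (T.unqueried x) (T.answers x)) : ℝ)
              ≤ K * ((q : ℝ) / (b : ℝ)) := by
  classical
  refine ⟨14, 1000, by norm_num, fun n hn b hb c q P f hP => ?_⟩
  obtain ⟨hb1, hb2⟩ := HybridLifting.two_pow_bounds (by omega) hb
  have hn' : (1000 : ℝ) ≤ n := by exact_mod_cast hn
  have hn0 : (0 : ℝ) < n := by linarith
  have hy : (n : ℝ)⁻¹ ≤ 1 / 1000 := by
    rw [inv_le_comm₀ hn0 (by norm_num)]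
    simpa using hn'
  have hy0 : 0 < (n : ℝ)⁻¹ := by positivity
  have hny : (n : ℝ) * (n : ℝ)⁻¹ = 1 := mul_inv_cancel₀ hn0.ne'
  have hbpos : 0 < b := by
    rcases Nat.eq_zero_or_pos b with rfl | h
    · have : (n : ℝ) ≤ (n : ℝ) ^ 20 := le_self_pow₀ (by linarith) (by norm_num)
      norm_num at hb2
      linarith
    · exact h
  have hb0 : (0 : ℝ) < b := by exact_mod_cast hbpos
  have hb21 : (2 : ℝ) ^ b ≤ (n : ℝ) ^ 21 := by
    calc (2 : ℝ) ^ b ≤ 2 * (n : ℝ) ^ 20 := hb1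
      _ ≤ n * (n : ℝ) ^ 20 := by gcongr; linarith
      _ = (n : ℝ) ^ 21 := by ring
  set R := HybridLifting.standardRates hn hb1 with hR
  have hr : R.r₁ = (n : ℝ)⁻¹ ^ 19 := rfl
  have hrN : (n : ℝ) / 2 ≤ R.r₁ * 2 ^ b := by
    rw [hr]
    calc (n : ℝ) / 2 = (n : ℝ) / 2 * 1 ^ 19 := by ring
      _ = (n : ℝ)⁻¹ ^ 19 * ((n : ℝ) ^ 20 / 2) := by rw [← hny]; ring
      _ ≤ (n : ℝ)⁻¹ ^ 19 * 2 ^ b := by gcongr; linarith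
  have hρ : 1 ≤ R.r₁ * 2 ^ b / 8 := by linarith
  set L : Finset (Fin n) → (Fin n → HybridLifting.Bit) → Prop := fun J x =>
    (HybridLifting.approxDegree (1 / 3) (HybridLifting.restriction f J fun i => x i) : ℝ) ≤
      14 * ((q : ℝ) / (b : ℝ)) with hL
  set k : ℕ := ⌊200 * (c : ℝ) / (b : ℝ)⌋₊ with hk
  -- From `2 ^ b ≤ n ^ 21` and `n ≤ (r₁ * 2 ^ b / 8) ^ 2`, raising to the power 42 reduces the claim
  -- to `84 * c < b * (k + 1)`, well within the allowance of 200.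
  have hpot : (1 : ℝ) * 4 ^ c < (R.r₁ * 2 ^ b / 8) ^ (k + 1) := by
    have h1 : 200 * c < b * (k + 1) := by
      have h := Nat.lt_floor_add_one (200 * (c : ℝ) / (b : ℝ))
      rw [div_lt_iff₀ hb0] at h
      have h' : (200 : ℝ) * c < b * (k + 1) := by rw [hk]; linarith
      exact_mod_cast h'
    have h2 : (n : ℝ) ≤ (R.r₁ * 2 ^ b / 8) ^ 2 := by
      have h : (n : ℝ) / 16 ≤ R.r₁ * 2 ^ b / 8 := by linarith
      nlinarith
    have h3 : ((4 : ℝ) ^ c) ^ 42 < ((R.r₁ * 2 ^ b / 8) ^ (k + 1)) ^ 42 := by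
      calc ((4 : ℝ) ^ c) ^ 42 = 2 ^ (84 * c) := by
            rw [show (4 : ℝ) = 2 ^ 2 by norm_num, ← pow_mul, ← pow_mul]
            congr 1
            ring
        _ < 2 ^ (b * (k + 1)) := pow_lt_pow_right₀ one_lt_two (by omega)
        _ = (2 ^ b) ^ (k + 1) := pow_mul _ _ _
        _ ≤ ((n : ℝ) ^ 21) ^ (k + 1) := by gcongr
        _ ≤ (((R.r₁ * 2 ^ b / 8) ^ 2) ^ 21) ^ (k + 1) := by gcongr
        _ = _ := by simp only [← pow_mul]; congr 1; ring
    rw [one_mul]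
    exact lt_of_pow_lt_pow_left₀ 42 (by positivity) h3
  obtain ⟨E, _, u, v, hu, hv, huv⟩ := P.quantum.exists_probNegOne_eq q
  have hreach : HybridLifting.Reachable L k Finset.univ 0 := by
    refine HybridLifting.reachable_of_transcript R (L := L) hρ P.classical
      (c := c) ?_ c 0 (zero_add c) Fin.elim0 1 Finset.univ 0 Finset.univ Finset.univ k
      (HybridLifting.structured_univ (by linarith) 0) (fun _ _ _ _ => rfl) hpot
    intro Φ J z A B τ hst hτ x hx
    set D : ℕ := ⌊14 * ((q : ℝ) / (b : ℝ))⌋₊ with hD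
    have hDb : 14 * q ≤ b * (D + 1) := by
      have h := (Nat.lt_floor_add_one (14 * ((q : ℝ) / (b : ℝ)))).le
      rw [mul_div_assoc', div_le_iff₀ hb0] at h
      have h' : (14 : ℝ) * q ≤ b * (D + 1) := by rw [hD, mul_div_assoc']; linarith
      exact_mod_cast h'
    -- Here `K = 14` enters: `4 ^ (7 * q) = 2 ^ (14 * q) ≤ 2 ^ (b * (D + 1)) ≤ n ^ (21 * (D + 1))`.
    have h4q : (4 : ℝ) ^ q ≤ (n : ℝ) ^ (3 * (D + 1)) := by
      refine le_of_pow_le_pow_left₀ (n := 7) (by norm_num) (by positivity) ?_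
      calc ((4 : ℝ) ^ q) ^ 7 = 2 ^ (14 * q) := by
            rw [show (4 : ℝ) = 2 ^ 2 by norm_num, ← pow_mul, ← pow_mul]
            congr 1
            ring
        _ ≤ 2 ^ (b * (D + 1)) := pow_le_pow_right₀ one_le_two hDb
        _ = (2 ^ b) ^ (D + 1) := pow_mul _ _ _
        _ ≤ ((n : ℝ) ^ 21) ^ (D + 1) := by gcongr
        _ = _ := by simp only [← pow_mul]; congr 1; ring
    have hrest : HybridLifting.restriction f J (fun i => x i) =
        HybridLifting.restriction f J (fun i => z i) := by
      congr 1
      funext i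
      exact hx i i.2
    have hdeg : HybridLifting.approxDegree (1 / 3)
        (HybridLifting.restriction f J fun i => z i) ≤ D := by
      have hsq : (n : ℝ) * (n : ℝ)⁻¹ ^ 2 = (n : ℝ)⁻¹ := by rw [sq, ← mul_assoc, hny, one_mul]
      have h8 : (n : ℝ) * (n : ℝ)⁻¹ ^ 8 ≤ (n : ℝ)⁻¹ :=
        (mul_le_mul_of_nonneg_left (pow_le_pow_of_le_one hy0.le (by linarith) (by norm_num))
          hn0.le).trans_eq hsq
      -- `a ^ 2 = n ^ (-16)` dominates `r₁ ^ 2 * 2 ^ b ≤ 2 * n ^ (-18)`. Of `d ^ (D + 1) = n ^ (-6(D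
      -- + 1))`, one half cancels `4 ^ q` and the other makes the tail small.
      refine HybridLifting.approxDegree_restriction_le f (a := (n : ℝ)⁻¹ ^ 8)
        (d := (n : ℝ)⁻¹ ^ 6) (g := (n : ℝ)⁻¹ ^ 2) (C := 4 ^ q) (by positivity) ?_
        (by positivity) (by positivity) (pow_le_one₀ hy0.le (by linarith)) (by positivity)
        (by rw [← pow_add]) hst (fun x => u (x, τ)) (fun y => v (y, τ))
        (fun x _ => hu _) (fun y _ => hv _) (fun x hx y hy => ?_) ?_ D ?_
      · rw [hr]
        calc ((n : ℝ)⁻¹ ^ 19) ^ 2 * 2 ^ b ≤ ((n : ℝ)⁻¹ ^ 19) ^ 2 * (2 * (n : ℝ) ^ 20) := by gcongr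
          _ = 2 * (n : ℝ)⁻¹ ^ 18 * ((n : ℝ) * (n : ℝ)⁻¹) ^ 20 := by ring
          _ = (n : ℝ)⁻¹ ^ 16 * (2 * (n : ℝ)⁻¹ * (n : ℝ)⁻¹) := by rw [hny]; ring
          _ ≤ (n : ℝ)⁻¹ ^ 16 * 1 := by gcongr; nlinarith
          _ = _ := by ring
      · have h := hP.abs_sub_le x y (hτ x hx y hy)
        rw [huv] at h
        exact h.trans (by norm_num)
      · have h := HybridLifting.one_add_pow_sub_one_le (n := n) (x := (n : ℝ)⁻¹ ^ 8)
          (by positivity) (by linarith)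
        linarith
      · have h := HybridLifting.one_add_pow_sub_one_le (n := n) (x := (n : ℝ)⁻¹ ^ 2)
          (by positivity) (by rw [hsq]; linarith)
        rw [hsq] at h
        have h1 : (1 : ℝ) ≤ 4 ^ q := one_le_pow₀ (by norm_num)
        have h2 : (4 : ℝ) ^ q * (n : ℝ)⁻¹ ^ (3 * (D + 1)) ≤ 1 := by
          rw [inv_pow, ← div_eq_mul_inv, div_le_one (by positivity)]
          exact h4q
        have h3 : (n : ℝ)⁻¹ ^ (3 * (D + 1)) ≤ 1 / 1000 :=
          (pow_le_of_le_one hy0.le (by linarith) (by positivity)).trans hy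
        have h5 : ((n : ℝ)⁻¹ ^ 6) ^ (D + 1) =
            (n : ℝ)⁻¹ ^ (3 * (D + 1)) * (n : ℝ)⁻¹ ^ (3 * (D + 1)) := by
          rw [← pow_mul, ← pow_add]
          congr 1
          ring
        rw [h5]
        have h6 : 0 < (n : ℝ)⁻¹ ^ (3 * (D + 1)) := by positivity
        calc (1 + 2 * (4 : ℝ) ^ q) * ((n : ℝ)⁻¹ ^ (3 * (D + 1)) * (n : ℝ)⁻¹ ^ (3 * (D + 1))) *
              (1 + (n : ℝ)⁻¹ ^ 2) ^ n
            ≤ (3 * (4 : ℝ) ^ q) * ((n : ℝ)⁻¹ ^ (3 * (D + 1)) * (n : ℝ)⁻¹ ^ (3 * (D + 1))) * 2 := by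
              gcongr <;> linarith
          _ = 6 * ((4 : ℝ) ^ q * (n : ℝ)⁻¹ ^ (3 * (D + 1))) * (n : ℝ)⁻¹ ^ (3 * (D + 1)) := by ring
          _ ≤ 6 * 1 * (1 / 1000) := by gcongr
          _ ≤ 1 / 20 := by norm_num
    change (HybridLifting.approxDegree (1 / 3)
      (HybridLifting.restriction f J fun i => x i) : ℝ) ≤ _
    rw [hrest]
    exact (Nat.cast_le.mpr hdeg).trans (Nat.floor_le (by positivity))
  obtain ⟨T, hT, hTL⟩ := hreach
  refine ⟨T, ?_, fun x => ?_⟩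
  · exact (Nat.cast_le.mpr hT).trans (Nat.floor_le (by positivity))
  · exact hTL x fun i hi => absurd (Finset.mem_univ i) hi
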